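/- **Setting.** A *regularity structure* $\mathscr T=(A,T,G)$ consists of a set $A\subset\mathbb R$ that is bounded from below and has no accumulation point, a graded vector space $T=\bigoplus_{\alpha\in A}T_\alpha$ whose components $T_\alpha$ are real Banach spaces, and a group $G$ of invertible continuous linear operators on $T$ such that $\Gamma\tau-\tau\in T_{<\alpha}:=\bigoplus_{\beta<\alpha}T_\beta$ for all $\Gamma\in G$, $\alpha\in A$ and $\tau\in T_\alpha$. (A linear operator $\Gamma$ on $T$ is called continuous if all its components $T_\alpha\to T_\beta$, $\alpha,\beta\in A$, are continuous; a linear map from $T$ to a topological vector space is called continuous if its restriction to each $T_\alpha$ is.) For $\tau\in T$, $\|\tau\|_\alpha$ is the norm of the component of $\tau$ in $T_\alpha$. Let $d\ge1$ be an integer. For a test function $\phi\in C_c^\infty(\mathbb R^d)$, $x\in\mathbb R^d$ and $\lambda>0$ put $\phi_x^\lambda(y)=\lambda^{-d}\phi(\lambda^{-1}(y-x))$. For real $r>0$ let $\mathcal B_r$ be the set of smooth $\phi:\mathbb R^d\to\mathbb R$ supported in the closed unit ball around $0$ with $\|\phi\|_{C^r}\le1$, meaning that all derivatives $D^k\phi$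 with $k\le r$ are bounded by $1$ and, if $r\notin\mathbb N$, that $|D^{\lfloor r\rfloor}\phi(y)-D^{\lfloor r\rfloor}\phi(z)|\le|y-z|^{r-\lfloor r\rfloor}$ for all $y,z$. Let $\mathcal D'(\mathbb R^d)$ be the space of (not necessarily tempered) distributions on $\mathbb R^d$. Fix a real number $r>|\inf A|$ (with $\inf\emptyset:=0$). A *model* for $\mathscr T$ on $\mathbb R^d$ consists of continuous linear maps $\Pi_x:T\to\mathcal D'(\mathbb R^d)$, $x\in\mathbb R^d$, and elements $\Gamma_{xy}\in G$, $x,y\in\mathbb R^d$, with $\Gamma_{xy}\Gamma_{yz}=\Gamma_{xz}$ and $\Pi_x\Gamma_{xy}=\Pi_y$, such that for every compact $K\subset\mathbb R^d$ and every $\eta>0$ there is a constant $C$ with $$|(\Pi_x\tau)(\phi_x^\lambda)|\le C\lambda^{\alpha}\|\tau\|_\alpha,\qquad \|\Gamma_{xy}\tau\|_\beta\le C|x-y|^{\alpha-\beta}\|\tau\|_\alpha$$ for all $\phi\in\mathcal B_r$, $x,y\in K$, $\lambda\in(0,1]$, $\alpha\in A$ with $\alpha\le\eta$, $\tau\in T_\alpha$,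 and $\beta\in A$ with $\beta<\alpha$. For $\gamma\in\mathbb R$, $\mathcal D^\gamma$ is the vector space of functions $f:\mathbb R^d\to\bigoplus_{\alpha\in A,\,\alpha<\gamma}T_\alpha$ such that for every compact $K\subset\mathbb R^d$ and every $\alpha\in A$ with $\alpha<\gamma$ there is a constant $C$ with $\|f(x)-\Gamma_{xy}f(y)\|_\alpha\le C|x-y|^{\gamma-\alpha}$ for all $x,y\in K$. **Theorem (reconstruction).** Let $\mathscr T$ be a regularity structure, $r>|\inf A|$, $(\Pi,\Gamma)$ a model for $\mathscr T$ on $\mathbb R^d$, and $\gamma>0$. Then there is a unique linear map $\mathcal R:\mathcal D^\gamma\to\mathcal D'(\mathbb R^d)$ with the following property: for every $f\in\mathcal D^\gamma$ and every compact $K\subset\mathbb R^d$ there is a constant $C$ such that $$|(\mathcal Rf-\Pi_xf(x))(\phi_x^\lambda)|\le C\lambda^\gamma$$ for all $x\in K$, all $\phi\in\mathcal B_r$ and all $\lambda\in(0,1]$. -/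

import Mathlib

open scoped Distributions DirectSum

universe u

namespace RegStruct

noncomputable section

/-- A regularity structure `(A, T, G)`. The model space is the algebraic direct sum
`⨁ α : A, T α` of Banach spaces and `G` is a group of invertible linear operators on it.

Continuity of an operator `Γ` on the model space is required block by block: for all `α, β ∈ A`
the component `T α → T β` of `Γ` is continuous. If `A` is finite this is continuity for the product
topology; if `A` is infinite it is implied by continuity for the topology of termwise
convergence, and (as `Γ` maps `T α` to finitely many summands) it is equivalent to
continuity for the locally convex direct sum topology. -/
structure RegularityStructure where
  /-- the set of homogeneities -/
  A : Set ℝ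
  bddBelow : BddBelow A
  no_accPt : ∀ x : ℝ, ¬ AccPt x (Filter.principal A)
  /-- the homogeneous components of the model space -/
  T : A → Type u
  [normedAddCommGroup : ∀ α, NormedAddCommGroup (T α)]
  [normedSpace : ∀ α, NormedSpace ℝ (T α)]
  [completeSpace : ∀ α, CompleteSpace (T α)]
  /-- the structure group -/
  G : Subgroup ((⨁ α, T α) ≃ₗ[ℝ] (⨁ α, T α))
  continuous_block : ∀ Γ ∈ G, ∀ α β : A,
    Continuous fun τ : T α ↦ Γ (DirectSum.lof ℝ A T α τ) β
  /-- `Γ τ - τ ∈ T_{<α}` for `τ ∈ T_α` -/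
  triangular : ∀ Γ ∈ G, ∀ (α : A) (τ : T α) (β : A), ¬ β < α →
    (Γ (DirectSum.lof ℝ A T α τ) - DirectSum.lof ℝ A T α τ) β = 0

attribute [instance] RegularityStructure.normedAddCommGroup RegularityStructure.normedSpace
  RegularityStructure.completeSpace

namespace RegularityStructure

variable (S : RegularityStructure.{u})

/-- The model space `T = ⨁_{α ∈ A} T_α`. -/
abbrev ModelSpace : Type u := ⨁ α, S.T α

/-- The inclusion of `T_α` into the model space. -/
abbrev incl (α : S.A) : S.T α →ₗ[ℝ] S.ModelSpace := DirectSum.lof ℝ S.A S.T α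

end RegularityStructure

/-- The Euclidean space `ℝ^d`. -/
abbrev Space (d : ℕ) : Type := EuclideanSpace ℝ (Fin d)

/-- Smooth compactly supported real test functions on `ℝ^d`. -/
abbrev TestFn (d : ℕ) : Type := 𝓓((⊤ : TopologicalSpace.Opens (Space d)), ℝ)

/-- Distributions on `ℝ^d` (not necessarily tempered). -/
abbrev Distr (d : ℕ) : Type := 𝓓'((⊤ : TopologicalSpace.Opens (Space d)), ℝ)

/-- The rescaled and recentred test function `φ_x^l (y) = l^{-d} φ (l⁻¹ (y - x))`. -/
def rescale {d : ℕ} (φ : TestFn d) (x : Space d) (l : ℝ) (hl : 0 < l) : TestFn d where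
  toFun y := (l ^ d)⁻¹ * φ (l⁻¹ • (y - x))
  contDiff' := contDiff_const.mul
    (φ.contDiff.comp (by fun_prop))
  hasCompactSupport' := by
    have h : HasCompactSupport fun y : Space d ↦ φ (l⁻¹ • (y - x)) :=
      φ.hasCompactSupport.comp_homeomorph
        ((Homeomorph.subRight x).trans (Homeomorph.smulOfNeZero l⁻¹ (inv_ne_zero hl.ne')))
    exact h.mul_left
  tsupport_subset' := fun _ _ ↦ trivial

/-- `‖φ‖_{C^r} ≤ 1` for a smooth function `φ` and a real number `r ≥ 0`: all derivatives
of order at most `r` are bounded by `1` and, if `r` is not an integer, the derivatives of order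
`⌊r⌋` are `(r - ⌊r⌋)`-Hölder continuous with constant `1`. -/
def HolderNormLeOne {d : ℕ} (r : ℝ) (φ : Space d → ℝ) : Prop :=
  (∀ k : ℕ, (k : ℝ) ≤ r → ∀ y, ‖iteratedFDeriv ℝ k φ y‖ ≤ 1) ∧
  (∀ k : ℕ, (k : ℝ) < r → r < k + 1 → ∀ y z,
    ‖iteratedFDeriv ℝ k φ y - iteratedFDeriv ℝ k φ z‖ ≤ ‖y - z‖ ^ (r - k))

/-- The set `B_r` of smooth functions supported in the unit ball with `‖φ‖_{C^r} ≤ 1`. -/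
def testBall (d : ℕ) (r : ℝ) : Set (TestFn d) :=
  {φ | tsupport φ ⊆ Metric.closedBall 0 1 ∧ HolderNormLeOne r φ}

/-- A model `(Π, Γ)` for the regularity structure `S` on `ℝ^d`, the analytic bounds being tested
against the functions in `B_r`. -/
structure Model (S : RegularityStructure.{u}) (d : ℕ) (r : ℝ) where
  /-- the maps `Π_x : T → 𝓓'(ℝ^d)` -/
  Pi : Space d → S.ModelSpace →ₗ[ℝ] Distr d
  /-- the maps `Γ_{xy} ∈ G` -/
  Gam : Space d → Space d → S.G
  continuous_Pi : ∀ x (α : S.A), Continuous fun τ : S.T α ↦ Pi x (S.incl α τ)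
  Gam_mul : ∀ x y z, Gam x y * Gam y z = Gam x z
  Pi_Gam : ∀ x y (τ : S.ModelSpace),
    Pi x ((Gam x y : S.ModelSpace ≃ₗ[ℝ] S.ModelSpace) τ) = Pi y τ
  bounds : ∀ K : Set (Space d), IsCompact K → ∀ γ : ℝ, 0 < γ → ∃ C : ℝ,
    (∀ φ ∈ testBall d r, ∀ x ∈ K, ∀ l : ℝ, ∀ hl : 0 < l, l ≤ 1 →
      ∀ α : S.A, (α : ℝ) ≤ γ → ∀ τ : S.T α,
        |Pi x (S.incl α τ) (rescale φ x l hl)| ≤ C * l ^ (α : ℝ) * ‖τ‖) ∧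
    (∀ x ∈ K, ∀ y ∈ K, ∀ α : S.A, (α : ℝ) ≤ γ → ∀ τ : S.T α, ∀ β : S.A, β < α →
        ‖(Gam x y : S.ModelSpace ≃ₗ[ℝ] S.ModelSpace) (S.incl α τ) β‖
          ≤ C * ‖x - y‖ ^ ((α : ℝ) - β) * ‖τ‖)

/-- The space `D^γ` of functions `f : ℝ^d → ⨁_{α < γ} T_α` such that, for every compact set `K` and
every `α < γ`, `‖f x - Γ_{xy} (f y)‖_α ≤ C |x - y|^{γ - α}` uniformly over `x, y ∈ K`. -/
def Dgamma {S : RegularityStructure.{u}} {d : ℕ} {r : ℝ} (M : Model S d r) (γ : ℝ) :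
    Submodule ℝ (Space d → S.ModelSpace) where
  carrier := {f | (∀ x (α : S.A), γ ≤ (α : ℝ) → f x α = 0) ∧
    ∀ K : Set (Space d), IsCompact K → ∀ α : S.A, (α : ℝ) < γ → ∃ C : ℝ,
      ∀ x ∈ K, ∀ y ∈ K,
        ‖(f x - (M.Gam x y : S.ModelSpace ≃ₗ[ℝ] S.ModelSpace) (f y)) α‖
          ≤ C * ‖x - y‖ ^ (γ - α)}
  zero_mem' := by
    refine ⟨fun _ _ _ ↦ rfl, fun K _ α _ ↦ ⟨0, fun x _ y _ ↦ ?_⟩⟩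
    simp
  add_mem' := by
    rintro f g ⟨hf, hf'⟩ ⟨hg, hg'⟩
    refine ⟨fun x α h ↦ by simp [hf x α h, hg x α h], fun K hK α hα ↦ ?_⟩
    obtain ⟨C, hC⟩ := hf' K hK α hα
    obtain ⟨C', hC'⟩ := hg' K hK α hα
    refine ⟨C + C', fun x hx y hy ↦ ?_⟩
    have e : ((f + g) x - (M.Gam x y : S.ModelSpace ≃ₗ[ℝ] S.ModelSpace) ((f + g) y)) α
        = (f x - (M.Gam x y : S.ModelSpace ≃ₗ[ℝ] S.ModelSpace) (f y)) α
          + (g x - (M.Gam x y : S.ModelSpace ≃ₗ[ℝ] S.ModelSpace) (g y)) α := by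
      rw [← DirectSum.add_apply, Pi.add_apply, Pi.add_apply, map_add, add_sub_add_comm]
    rw [e, add_mul]
    exact (norm_add_le _ _).trans (add_le_add (hC x hx y hy) (hC' x hx y hy))
  smul_mem' := by
    rintro c f ⟨hf, hf'⟩
    refine ⟨fun x α h ↦ by simp [DirectSum.smul_apply, hf x α h], fun K hK α hα ↦ ?_⟩
    obtain ⟨C, hC⟩ := hf' K hK α hα
    refine ⟨‖c‖ * C, fun x hx y hy ↦ ?_⟩
    have e : ((c • f) x - (M.Gam x y : S.ModelSpace ≃ₗ[ℝ] S.ModelSpace) ((c • f) y)) α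
        = c • (f x - (M.Gam x y : S.ModelSpace ≃ₗ[ℝ] S.ModelSpace) (f y)) α := by
      rw [← DirectSum.smul_apply, Pi.smul_apply, Pi.smul_apply, map_smul, smul_sub]
    rw [e, norm_smul, mul_assoc]
    exact mul_le_mul_of_nonneg_left (hC x hx y hy) (norm_nonneg c)

end

end RegStruct

/-! Write `F x = Π_x f(x)`. If `|x - y| ≲ δ`, then `F x - F y = Π_x (f(x) - Γ_xy f(y))`, and tested
at scale `δ` its component in `T_α` contributes `δ^α δ^(γ-α) = δ^γ`: the germ `F` is coherent
(`coherentOn_modelled`). Cut a test function by a partition of unity of mesh `δ` and test each piece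
against `F` at the centre of its cell; this is `glue`. Halving the mesh involves about `(ρ/δ)^d`
pieces for a support of radius `ρ`, each changing the value by `O(δ^d δ^γ)`, so the total change is
`O(δ^γ)` (`abs_glue_half_sub_glue_le`). As `γ > 0`, this is summable along dyadic meshes and the
limit defines the reconstruction. On a test function of scale `λ`, the limit is compared with the
glued value at mesh about `λ`, and that value with `F x` (`exists_distr_of_coherentOn`). The same
count gives uniqueness: a distribution of size `δ^γ` on rescaled test functions is `O(δ^γ)` on a
fixed one, hence zero (`distr_eq_zero`). Linearity follows from uniqueness. The size of `g` at scale
`δ` is the `C^r` norm of `z ↦ g (δ • z)`; it does not grow as `δ` decreases, and it is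
submultiplicative up to a constant. -/

namespace RegStruct

open scoped ContDiff

/-! ### Calculus of the `C^r` norm. -/

variable {d : ℕ}

/-- `‖g‖_{C^r} ≤ B`: the version of `HolderNormLeOne` with an arbitrary constant. -/
def HolderBound (r B : ℝ) (g : Space d → ℝ) : Prop :=
  (∀ k : ℕ, (k : ℝ) ≤ r → ∀ y, ‖iteratedFDeriv ℝ k g y‖ ≤ B) ∧
  (∀ k : ℕ, (k : ℝ) < r → r < k + 1 → ∀ y z,
    ‖iteratedFDeriv ℝ k g y - iteratedFDeriv ℝ k g z‖ ≤ B * ‖y - z‖ ^ (r - k))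

namespace HolderBound

variable {r B B' : ℝ} {g h : Space d → ℝ}

theorem nonneg (hr : 0 ≤ r) (hg : HolderBound r B g) : 0 ≤ B :=
  (norm_nonneg _).trans (hg.1 0 (by simpa using hr) 0)

theorem of_holderNormLeOne (hg : HolderNormLeOne r g) : HolderBound r 1 g :=
  ⟨hg.1, by simpa using hg.2⟩

theorem holderNormLeOne (hg : HolderBound r 1 g) : HolderNormLeOne r g :=
  ⟨hg.1, by simpa using hg.2⟩

theorem const_mul (hg : HolderBound r B g) (hs : ContDiff ℝ ∞ g) (c : ℝ) :
    HolderBound r (|c| * B) fun z ↦ c * g z := by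
  have e (k : ℕ) (y : Space d) :
      iteratedFDeriv ℝ k (fun z ↦ c * g z) y = c • iteratedFDeriv ℝ k g y :=
    iteratedFDeriv_const_smul_apply' (a := c) (f := g)
      (hs.of_le (by exact_mod_cast le_top)).contDiffAt
  refine ⟨fun k hk y ↦ ?_, fun k hk hk' y z ↦ ?_⟩
  · rw [e, norm_smul, Real.norm_eq_abs]
    exact mul_le_mul_of_nonneg_left (hg.1 k hk y) (abs_nonneg c)
  · rw [e, e, ← smul_sub, norm_smul, Real.norm_eq_abs, mul_assoc]
    exact mul_le_mul_of_nonneg_left (hg.2 k hk hk' y z) (abs_nonneg c)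

/-- The chain rule produces factors `a ^ k` and `a ^ r`, all at most `1`. This is what lets a bound
at one scale be reused at every finer scale. -/
theorem comp_affine (hr : 0 ≤ r) (hg : HolderBound r B g) (hs : ContDiff ℝ ∞ g) {a : ℝ}
    (ha : 0 ≤ a) (ha' : a ≤ 1) (b : Space d) : HolderBound r B fun z ↦ g (a • z + b) := by
  have hB := hg.nonneg hr
  have e (k : ℕ) (y : Space d) :
      iteratedFDeriv ℝ k (fun z ↦ g (a • z + b)) y = a ^ k • iteratedFDeriv ℝ k g (a • y + b) := by
    have h1 : ContDiff ℝ k fun z ↦ g (z + b) :=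
      (hs.of_le (by exact_mod_cast le_top)).comp (by fun_prop)
    have h2 := congrFun (iteratedFDeriv_comp_const_smul a h1) y
    rw [iteratedFDeriv_comp_add_right] at h2
    exact h2
  refine ⟨fun k hk y ↦ ?_, fun k hk hk' y z ↦ ?_⟩
  · rw [e, norm_smul, norm_pow, Real.norm_of_nonneg ha]
    exact (mul_le_of_le_one_left (norm_nonneg _) (pow_le_one₀ ha ha')).trans (hg.1 k hk _)
  · rw [e, e, ← smul_sub, norm_smul, norm_pow, Real.norm_of_nonneg ha]
    refine (mul_le_of_le_one_left (norm_nonneg _) (pow_le_one₀ ha ha')).trans <|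
      (hg.2 k hk hk' _ _).trans ?_
    rw [add_sub_add_right_eq_sub, ← smul_sub, norm_smul, Real.norm_of_nonneg ha]
    have hrk : 0 ≤ r - k := by linarith
    gcongr
    exact mul_le_of_le_one_left (norm_nonneg _) ha'

end HolderBound

/-- Interpolation: the mean value inequality serves for `‖y - z‖ ≤ 1`, the triangle inequality for
`‖y - z‖ ≥ 1`. -/
theorem norm_iteratedFDeriv_sub_le {B : ℝ} {g : Space d → ℝ} (hs : ContDiff ℝ ∞ g) {i : ℕ}
    {s : ℝ} (hs0 : 0 ≤ s) (hs1 : s ≤ 1) (h0 : ∀ y, ‖iteratedFDeriv ℝ i g y‖ ≤ B)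
    (h1 : ∀ y, ‖iteratedFDeriv ℝ (i + 1) g y‖ ≤ B) (y z : Space d) :
    ‖iteratedFDeriv ℝ i g y - iteratedFDeriv ℝ i g z‖ ≤ 2 * B * ‖y - z‖ ^ s := by
  have hB : 0 ≤ B := (norm_nonneg _).trans (h0 0)
  rcases le_total ‖y - z‖ 1 with h | h
  · have hd : Differentiable ℝ (iteratedFDeriv ℝ i g) :=
      hs.differentiable_iteratedFDeriv (by exact_mod_cast WithTop.coe_lt_top i)
    have := (convex_univ (𝕜 := ℝ) (E := Space d)).norm_image_sub_le_of_norm_fderiv_le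
      (f := iteratedFDeriv ℝ i g) (C := B) (fun x _ ↦ hd x)
      (fun x _ ↦ by rw [norm_fderiv_iteratedFDeriv]; exact h1 x) (Set.mem_univ z) (Set.mem_univ y)
    refine this.trans ?_
    have h2 : ‖y - z‖ ≤ ‖y - z‖ ^ s := by
      rcases (norm_nonneg (y - z)).eq_or_lt with h3 | h3
      · rw [← h3]; exact Real.rpow_nonneg le_rfl _
      · simpa using Real.rpow_le_rpow_of_exponent_ge h3 h hs1
    calc B * ‖y - z‖ ≤ B * ‖y - z‖ ^ s := by gcongr
      _ ≤ 2 * B * ‖y - z‖ ^ s := by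
        gcongr; linarith
  · calc _ ≤ ‖iteratedFDeriv ℝ i g y‖ + ‖iteratedFDeriv ℝ i g z‖ := norm_sub_le _ _
      _ ≤ 2 * B * 1 := by linarith [h0 y, h0 z]
      _ ≤ _ := by gcongr; exact Real.one_le_rpow h hs0

theorem holderBound_of_norm_iteratedFDeriv_le {r B : ℝ} {g : Space d → ℝ}
    (hs : ContDiff ℝ ∞ g) (h : ∀ k : ℕ, k ≤ ⌊r⌋₊ + 1 → ∀ y, ‖iteratedFDeriv ℝ k g y‖ ≤ B) :
    HolderBound r (2 * B) g := by
  have hB : 0 ≤ B := (norm_nonneg _).trans (h 0 (Nat.zero_le _) 0)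
  refine ⟨fun k hk y ↦ ?_, fun k hk hk' y z ↦ ?_⟩
  · linarith [h k ((Nat.le_floor hk).trans (Nat.le_succ _)) y]
  · exact norm_iteratedFDeriv_sub_le hs (by linarith) (by linarith)
      (h k ((Nat.le_floor hk.le).trans (Nat.le_succ _)))
      (h (k + 1) (Nat.succ_le_succ (Nat.le_floor hk.le))) y z

theorem exists_holderBound (r : ℝ) {g : Space d → ℝ} (hs : ContDiff ℝ ∞ g)
    (hc : HasCompactSupport g) : ∃ B, HolderBound r B g := by
  have (k : ℕ) : ∃ C, ∀ x, ‖iteratedFDeriv ℝ k g x‖ ≤ C :=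
    (hs.continuous_iteratedFDeriv (by exact_mod_cast le_top)).bounded_above_of_compact_support
      (hc.iteratedFDeriv k)
  choose C hC using this
  refine ⟨_, holderBound_of_norm_iteratedFDeriv_le (B := ∑ k ∈ Finset.range (⌊r⌋₊ + 2), C k) hs
    fun k hk y ↦ (hC k y).trans ?_⟩
  exact Finset.single_le_sum (f := C) (fun i _ ↦ (norm_nonneg _).trans (hC i 0))
    (Finset.mem_range.2 (by omega))

namespace HolderBound

variable {r B B' : ℝ} {g h : Space d → ℝ}

theorem norm_sub_le (hr : 0 ≤ r) (hg : HolderBound r B g) (hs : ContDiff ℝ ∞ g) {k i : ℕ}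
    (hk : (k : ℝ) < r) (hk' : r < k + 1) (hi : i ≤ k) (y z : Space d) :
    ‖iteratedFDeriv ℝ i g y - iteratedFDeriv ℝ i g z‖ ≤ 2 * B * ‖y - z‖ ^ (r - k) := by
  have hB := hg.nonneg hr
  rcases hi.eq_or_lt with rfl | hi
  · refine (hg.2 i hk hk' y z).trans ?_
    gcongr; linarith
  · have h1 : (i : ℝ) + 1 ≤ k := by exact_mod_cast hi
    exact norm_iteratedFDeriv_sub_le hs (by linarith) (by linarith)
      (hg.1 i (by linarith)) (hg.1 (i + 1) (by push_cast; linarith)) y z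

/-- Leibniz rule, with binomial coefficients summing to `2 ^ k`. The Hölder part has two such terms,
each with a further factor `2` from `norm_sub_le`, whence the exponent `⌊r⌋₊ + 2`. -/
theorem mul (hr : 0 ≤ r) (hg : HolderBound r B g) (hh : HolderBound r B' h)
    (hgs : ContDiff ℝ ∞ g) (hhs : ContDiff ℝ ∞ h) :
    HolderBound r (2 ^ (⌊r⌋₊ + 2) * B * B') fun z ↦ g z * h z := by
  have hB := hg.nonneg hr
  have hB' := hh.nonneg hr
  have key {u v : Space d → ℝ} (hu : ContDiff ℝ ∞ u) (hv : ContDiff ℝ ∞ v) {k : ℕ} {a b : ℝ}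
      (y : Space d) (h1 : ∀ i ≤ k, ‖iteratedFDeriv ℝ i u y‖ ≤ a)
      (h2 : ∀ i ≤ k, ‖iteratedFDeriv ℝ i v y‖ ≤ b) :
      ‖iteratedFDeriv ℝ k (fun z ↦ u z * v z) y‖ ≤ 2 ^ k * (a * b) := by
    have ha : 0 ≤ a := (norm_nonneg _).trans (h1 0 (Nat.zero_le _))
    refine (norm_iteratedFDeriv_mul_le hu hv y (n := k) (by exact_mod_cast le_top)).trans ?_
    calc _ ≤ ∑ i ∈ Finset.range (k + 1), (k.choose i : ℝ) * (a * b) := by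
          refine Finset.sum_le_sum fun i hi ↦ ?_
          rw [mul_assoc]
          have : i ≤ k := Nat.lt_succ_iff.1 (Finset.mem_range.1 hi)
          gcongr
          · exact h1 i this
          · exact h2 _ (Nat.sub_le _ _)
      _ = 2 ^ k * (a * b) := by
          rw [← Finset.sum_mul]
          exact_mod_cast congrArg (fun n : ℕ ↦ (n : ℝ) * (a * b)) (Nat.sum_range_choose k)
  have le_r {i k : ℕ} (hk : (k : ℝ) ≤ r) (hi : i ≤ k) : (i : ℝ) ≤ r :=
    (Nat.cast_le.2 hi).trans hk
  refine ⟨fun k hk y ↦ ?_, fun k hk hk' y z ↦ ?_⟩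
  · refine (key hgs hhs y (fun i hi ↦ hg.1 i (le_r hk hi) y)
      fun i hi ↦ hh.1 i (le_r hk hi) y).trans ?_
    rw [mul_assoc]
    gcongr
    · norm_num
    · exact (Nat.le_floor hk).trans (Nat.le_add_right _ _)
  -- Translation by `w` turns the increment of a derivative into a derivative at `y` of `gh - g_w
  -- h_w = (g - g_w) h + g_w (h - h_w)`, where the Leibniz bound applies.
  · set w := z - y with hw
    have hz : z = y + w := by simp [hw]
    have shift {u : Space d → ℝ} (hu : ContDiff ℝ ∞ u) : ContDiff ℝ ∞ fun x ↦ u (x + w) :=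
      hu.comp (by fun_prop)
    have dshift {u : Space d → ℝ} (hu : ContDiff ℝ ∞ u) (i : ℕ) (x : Space d) :
        iteratedFDeriv ℝ i (fun x ↦ u x - u (x + w)) x
          = iteratedFDeriv ℝ i u x - iteratedFDeriv ℝ i u (x + w) := by
      have h1 : ContDiffAt ℝ i u x := (hu.of_le (by exact_mod_cast le_top)).contDiffAt
      have h2 : ContDiffAt ℝ i (fun x ↦ u (x + w)) x :=
        ((shift hu).of_le (by exact_mod_cast le_top)).contDiffAt
      rw [← iteratedFDeriv_comp_add_right i w x]
      exact iteratedFDeriv_sub_apply h1 h2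
    have e : iteratedFDeriv ℝ k (fun z ↦ g z * h z) y - iteratedFDeriv ℝ k (fun z ↦ g z * h z) z
        = iteratedFDeriv ℝ k (fun x ↦ (g x - g (x + w)) * h x) y
          + iteratedFDeriv ℝ k (fun x ↦ g (x + w) * (h x - h (x + w))) y := by
      have h1 : ContDiff ℝ k fun x ↦ (g x - g (x + w)) * h x :=
        ((hgs.sub (shift hgs)).mul hhs).of_le (by exact_mod_cast le_top)
      have h2 : ContDiff ℝ k fun x ↦ g (x + w) * (h x - h (x + w)) :=
        ((shift hgs).mul (hhs.sub (shift hhs))).of_le (by exact_mod_cast le_top)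
      rw [hz, ← dshift (hgs.mul hhs) k y, ← iteratedFDeriv_add_apply h1.contDiffAt h2.contDiffAt]
      congr 1
      ext x
      simp only [Pi.add_apply]
      ring
    have hyz : ‖y - z‖ = ‖y - (y + w)‖ := by rw [← hz]
    set t := ‖y - z‖ ^ (r - k) with ht
    have ht0 : 0 ≤ t := Real.rpow_nonneg (norm_nonneg _) _
    have b1 := key (hgs.sub (shift hgs)) hhs (k := k) y (a := 2 * B * t) (b := B')
      (fun i hi ↦ by rw [dshift hgs, ht, hyz]; exact hg.norm_sub_le hr hgs hk hk' hi _ _)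
      (fun i hi ↦ hh.1 i (le_r hk.le hi) y)
    have b2 := key (shift hgs) (hhs.sub (shift hhs)) (k := k) y (a := B) (b := 2 * B' * t)
      (fun i hi ↦ by rw [iteratedFDeriv_comp_add_right]; exact hg.1 i (le_r hk.le hi) _)
      (fun i hi ↦ by rw [dshift hhs, ht, hyz]; exact hh.norm_sub_le hr hhs hk hk' hi _ _)
    rw [e]
    refine (norm_add_le _ _).trans ((add_le_add b1 b2).trans ?_)
    have hkf : k ≤ ⌊r⌋₊ := Nat.le_floor hk.le
    calc 2 ^ k * (2 * B * t * B') + 2 ^ k * (B * (2 * B' * t))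
        = 2 ^ (k + 2) * B * B' * t := by ring
      _ ≤ 2 ^ (⌊r⌋₊ + 2) * B * B' * t := by
        gcongr
        norm_num

end HolderBound

/-! ### Partitions of unity by translates. -/

/-- A smooth partition of unity `∑ k, θ (z - p k) = 1` on `ℝ^d` by translates of a function supported
in the unit ball, along points `p k` of bounded density. -/
structure TranslatePartition (d : ℕ) where
  θ : Space d → ℝ
  p : (Fin d → ℤ) → Space d
  density : ℝ
  contDiff : ContDiff ℝ ∞ θ
  norm_le_one : ∀ z, θ z ≠ 0 → ‖z‖ ≤ 1
  density_nonneg : 0 ≤ density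
  finite : ∀ z R, {k | ‖p k - z‖ ≤ R}.Finite
  card_le : ∀ z R, 1 ≤ R → ∀ F : Finset (Fin d → ℤ), (∀ k ∈ F, ‖p k - z‖ ≤ R) →
    (F.card : ℝ) ≤ density * R ^ d
  sum_eq_one : ∀ z, ∀ F : Finset (Fin d → ℤ), (∀ k, θ (z - p k) ≠ 0 → k ∈ F) →
    ∑ k ∈ F, θ (z - p k) = 1

/-- A smooth bump on `[-1, 1]` whose integer translates sum to `1`. -/
noncomputable def bumpStep (t : ℝ) : ℝ := Real.smoothTransition (t + 1) - Real.smoothTransition t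

theorem abs_lt_one_of_bumpStep_ne_zero {t : ℝ} (h : bumpStep t ≠ 0) : |t| < 1 := by
  contrapose! h
  rcases le_abs.1 h with h | h
  · simp [bumpStep, Real.smoothTransition.one_of_one_le h,
      Real.smoothTransition.one_of_one_le (by linarith : (1 : ℝ) ≤ t + 1)]
  · simp [bumpStep, Real.smoothTransition.zero_of_nonpos (by linarith : t ≤ 0),
      Real.smoothTransition.zero_of_nonpos (by linarith : t + 1 ≤ 0)]

/-- The two translates telescope to a value of `Real.smoothTransition` at a point `≥ 1` minus one at
a point `≤ 0`. -/
theorem bumpStep_add_bumpStep (t : ℝ) :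
    ∑ m ∈ {⌊t⌋, ⌊t⌋ + 1}, bumpStep (t - (m : ℤ)) = 1 := by
  rw [Finset.sum_pair (by simp)]
  have h1 := Int.floor_le t
  have h2 := Int.lt_floor_add_one t
  have e : t - ((⌊t⌋ + 1 : ℤ) : ℝ) + 1 = t - ⌊t⌋ := by push_cast; ring
  rw [bumpStep, bumpStep, e, Real.smoothTransition.one_of_one_le (by linarith),
    Real.smoothTransition.zero_of_nonpos (x := t - ((⌊t⌋ + 1 : ℤ) : ℝ)) (by push_cast; linarith)]
  ring

theorem mem_of_bumpStep_ne_zero {t : ℝ} {m : ℤ} (h : bumpStep (t - m) ≠ 0) :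
    m ∈ ({⌊t⌋, ⌊t⌋ + 1} : Finset ℤ) := by
  have h3 := abs_lt.1 (abs_lt_one_of_bumpStep_ne_zero h)
  have h4 : ⌊t⌋ < m + 1 := Int.floor_lt.2 (by push_cast; linarith)
  have h5 : m < ⌊t⌋ + 2 := by
    have : (m : ℝ) < ⌊t⌋ + 2 := by linarith [Int.lt_floor_add_one t]
    exact_mod_cast this
  rw [Finset.mem_insert, Finset.mem_singleton]
  omega

/-- The translates of a product bump along the grid `(d + 1)⁻¹ ℤ^d`. -/
noncomputable def gridPartition (d : ℕ) : TranslatePartition d :=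
  have hL : (0 : ℝ) < d + 1 := by positivity
  have box (z : Space d) (R : ℝ) (k : Fin d → ℤ)
      (hk : ‖WithLp.toLp 2 (fun i ↦ (k i : ℝ) / (d + 1)) - z‖ ≤ R) :
      k ∈ Fintype.piFinset fun i ↦
        Finset.Icc ⌈(d + 1) * z i - (d + 1) * R⌉ ⌊(d + 1) * z i + (d + 1) * R⌋ := by
    refine Fintype.mem_piFinset.2 fun i ↦ Finset.mem_Icc.2 ?_
    have h1 : |(k i : ℝ) / (d + 1) - z i| ≤ R := (PiLp.norm_apply_le _ i).trans hk
    have h2 : |(k i : ℝ) - (d + 1) * z i| ≤ (d + 1) * R := by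
      have : (k i : ℝ) - (d + 1) * z i = (d + 1) * ((k i : ℝ) / (d + 1) - z i) := by field_simp
      rw [this, abs_mul, abs_of_pos hL]
      gcongr
    have h3 := abs_le.1 h2
    exact ⟨Int.ceil_le.2 (by linarith), Int.le_floor.2 (by linarith)⟩
  { θ := fun z ↦ ∏ i, bumpStep ((d + 1) * z i)
    p := fun k ↦ WithLp.toLp 2 fun i ↦ (k i : ℝ) / (d + 1)
    density := (2 * (d + 1) + 1) ^ d
    contDiff := by
      refine contDiff_prod fun i _ ↦ ?_
      have h : ContDiff ℝ ∞ bumpStep :=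
        (Real.smoothTransition.contDiff.comp (contDiff_id.add contDiff_const)).sub
          Real.smoothTransition.contDiff
      exact h.comp (by fun_prop)
    norm_le_one := fun z hz ↦ by
      -- The grid has step `1 / (d + 1)` so that the cube carrying the bump lies in the Euclidean
      -- unit ball: `d / (d + 1) ^ 2 ≤ 1`.
      have h (i : Fin d) : ‖z i‖ ^ 2 ≤ 1 / (d + 1) ^ 2 := by
        have h1 := abs_lt_one_of_bumpStep_ne_zero (Finset.prod_ne_zero_iff.1 hz i (Finset.mem_univ i))
        rw [abs_mul, abs_of_pos hL] at h1
        rw [le_div_iff₀ (by positivity), ← mul_pow, mul_comm]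
        exact pow_le_one₀ (by positivity) h1.le
      rw [EuclideanSpace.norm_eq, Real.sqrt_le_one]
      refine (Finset.sum_le_sum fun i _ ↦ h i).trans ?_
      rw [Finset.sum_const, Finset.card_univ, Fintype.card_fin, nsmul_eq_mul, mul_one_div,
        div_le_one (by positivity)]
      nlinarith [(Nat.cast_nonneg d : (0 : ℝ) ≤ d)]
    density_nonneg := by positivity
    finite := fun z R ↦ (Finset.finite_toSet _).subset (box z R)
    card_le := fun z R hR F hF ↦ by
      have h1 := Finset.card_le_card fun k hk ↦ box z R k (hF k hk)
      rw [Fintype.card_piFinset] at h1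
      refine (Nat.cast_le.2 h1).trans ?_
      rw [Nat.cast_prod, ← mul_pow]
      refine (Finset.prod_le_prod (g := fun _ ↦ (2 * (d + 1) + 1) * R) (fun i _ ↦ Nat.cast_nonneg _)
        fun i _ ↦ ?_).trans (by simp)
      rw [Int.card_Icc]
      set a := (d + 1) * z i - (d + 1) * R
      set b := (d + 1) * z i + (d + 1) * R with hb
      have hab : b = a + 2 * ((d + 1) * R) := by ring
      have hLR : (0 : ℝ) < (d + 1) * R := by positivity
      have h2 : ((⌊b⌋ + 1 - ⌈a⌉ : ℤ) : ℝ) ≤ (2 * (d + 1) + 1) * R := by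
        push_cast
        linarith [Int.floor_le b, Int.le_ceil a]
      rcases le_total (⌊b⌋ + 1 - ⌈a⌉) 0 with h3 | h3
      · rw [Int.toNat_of_nonpos h3]
        push_cast
        positivity
      · rw [← Int.cast_natCast (R := ℝ), Int.toNat_of_nonneg h3]
        exact h2
    sum_eq_one := fun z F hF ↦ by
      classical
      have e (k : Fin d → ℤ) : ∏ i, bumpStep ((d + 1) * (z -
          (WithLp.toLp 2 fun i ↦ (k i : ℝ) / (d + 1) : Space d)) i)
          = ∏ i, bumpStep ((d + 1) * z i - k i) := by
        refine Finset.prod_congr rfl fun i _ ↦ congrArg _ ?_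
        simp only [PiLp.sub_apply]
        field_simp
      simp only [e] at hF ⊢
      have hG (k : Fin d → ℤ) (hk : ∏ i, bumpStep ((d + 1) * z i - k i) ≠ 0) :
          k ∈ Fintype.piFinset fun i ↦
            ({⌊((d : ℝ) + 1) * z i⌋, ⌊((d : ℝ) + 1) * z i⌋ + 1} : Finset ℤ) :=
        Fintype.mem_piFinset.2 fun i ↦
          mem_of_bumpStep_ne_zero (Finset.prod_ne_zero_iff.1 hk i (Finset.mem_univ i))
      -- The sum over `F` is moved to the box of `2 ^ d` neighbouring grid points, where it factors
      -- over coordinates.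
      rw [← finsum_eq_sum_of_support_subset _ (fun k hk ↦ hF k hk),
        finsum_eq_sum_of_support_subset _ (fun k hk ↦ hG k hk),
        ← Finset.prod_univ_sum (fun i ↦ ({⌊((d : ℝ) + 1) * z i⌋, ⌊((d : ℝ) + 1) * z i⌋ + 1} : Finset ℤ))
          (fun i m ↦ bumpStep ((d + 1) * z i - m))]
      exact Finset.prod_eq_one fun i _ ↦ bumpStep_add_bumpStep _ }

/-! ### Localisation and rescaling of test functions. -/

variable {d : ℕ}

/-- Multiplication of test functions by a smooth function. -/
noncomputable def smoothMul (u : Space d → ℝ) (hu : ContDiff ℝ ∞ u) : TestFn d →ₗ[ℝ] TestFn d where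
  toFun ψ :=
    { toFun := fun y ↦ u y * ψ y
      contDiff' := hu.mul ψ.contDiff
      hasCompactSupport' := ψ.hasCompactSupport.mul_left
      tsupport_subset' := fun _ _ ↦ trivial }
  map_add' φ ψ := by ext y; exact mul_add _ _ _
  map_smul' c ψ := by ext y; exact mul_left_comm _ _ _

@[simp]
theorem rescale_apply (φ : TestFn d) (x : Space d) (l : ℝ) (hl : 0 < l) (y : Space d) :
    rescale φ x l hl y = (l ^ d)⁻¹ * φ (l⁻¹ • (y - x)) := rfl

theorem exists_forall_norm_le (ψ : TestFn d) : ∃ ρ : ℝ, 1 ≤ ρ ∧ ∀ y, ψ y ≠ 0 → ‖y - 0‖ ≤ ρ := by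
  obtain ⟨ρ, hρ⟩ := ψ.hasCompactSupport.isBounded.exists_norm_le
  exact ⟨max 1 ρ, le_max_left _ _, fun y hy ↦ by
    simpa using Or.inr (hρ y (subset_tsupport _ hy))⟩

namespace TranslatePartition

variable (P : TranslatePartition d)

theorem exists_holderBound (r : ℝ) : ∃ B, HolderBound r B P.θ :=
  RegStruct.exists_holderBound r P.contDiff <|
    (isCompact_closedBall 0 1).of_isClosed_subset (isClosed_tsupport _) <|
      closure_minimal (fun z hz ↦ by simpa using P.norm_le_one z hz) Metric.isClosed_closedBall

/-- The `k`-th function of the partition of unity at mesh `δ`. -/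
noncomputable def cell (δ : ℝ) (k : Fin d → ℤ) (y : Space d) : ℝ := P.θ (δ⁻¹ • y - P.p k)

theorem contDiff_cell (δ : ℝ) (k : Fin d → ℤ) : ContDiff ℝ ∞ (P.cell δ k) :=
  P.contDiff.comp (by fun_prop)

/-- Localisation of test functions to the `k`-th cell at mesh `δ`. -/
noncomputable def cut (δ : ℝ) (k : Fin d → ℤ) : TestFn d →ₗ[ℝ] TestFn d :=
  smoothMul (P.cell δ k) (P.contDiff_cell δ k)

theorem cut_apply (δ : ℝ) (k : Fin d → ℤ) (ψ : TestFn d) (y : Space d) :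
    P.cut δ k ψ y = P.cell δ k y * ψ y := rfl

theorem cut_comm (δ δ' : ℝ) (k j : Fin d → ℤ) (ψ : TestFn d) :
    P.cut δ k (P.cut δ' j ψ) = P.cut δ' j (P.cut δ k ψ) := by
  ext y; exact mul_left_comm _ _ _

theorem norm_sub_le_of_cell_ne_zero {δ : ℝ} (hδ : 0 < δ) {k : Fin d → ℤ} {y : Space d}
    (h : P.cell δ k y ≠ 0) : ‖y - δ • P.p k‖ ≤ δ := by
  have h1 := P.norm_le_one _ h
  have : y - δ • P.p k = δ • (δ⁻¹ • y - P.p k) := by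
    rw [smul_sub, smul_smul, mul_inv_cancel₀ hδ.ne', one_smul]
  rw [this, norm_smul, Real.norm_of_nonneg hδ.le]
  exact mul_le_of_le_one_right hδ.le h1

theorem exists_of_cut_ne_zero {δ : ℝ} {k : Fin d → ℤ} {ψ : TestFn d} (h : P.cut δ k ψ ≠ 0) :
    ∃ y, P.cell δ k y ≠ 0 ∧ ψ y ≠ 0 := by
  by_contra! H
  refine h (TestFunction.ext fun y ↦ ?_)
  by_cases hy : P.cell δ k y = 0
  · exact mul_eq_zero_of_left hy _
  · exact mul_eq_zero_of_right _ (H y hy)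

theorem norm_sub_le_of_cut_ne_zero {δ ρ : ℝ} (hδ : 0 < δ) {k : Fin d → ℤ} {ψ : TestFn d}
    {x : Space d} (hψ : ∀ y, ψ y ≠ 0 → ‖y - x‖ ≤ ρ) (h : P.cut δ k ψ ≠ 0) :
    ‖δ • P.p k - x‖ ≤ δ + ρ := by
  obtain ⟨y, hy, hy'⟩ := P.exists_of_cut_ne_zero h
  have h1 := P.norm_sub_le_of_cell_ne_zero hδ hy
  have h2 := hψ y hy'
  rw [norm_sub_rev] at h1
  have := norm_sub_le_norm_sub_add_norm_sub (δ • P.p k) y x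
  linarith

theorem norm_smul_sub_le_iff {δ R : ℝ} (hδ : 0 < δ) {k : Fin d → ℤ} {x : Space d} :
    ‖δ • P.p k - x‖ ≤ R ↔ ‖P.p k - δ⁻¹ • x‖ ≤ δ⁻¹ * R := by
  have : δ • P.p k - x = δ • (P.p k - δ⁻¹ • x) := by
    rw [smul_sub, smul_smul, mul_inv_cancel₀ hδ.ne', one_smul]
  rw [this, norm_smul, Real.norm_of_nonneg hδ.le, le_inv_mul_iff₀ hδ]

theorem finite_norm_smul_sub_le {δ : ℝ} (hδ : 0 < δ) (x : Space d) (R : ℝ) :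
    {k | ‖δ • P.p k - x‖ ≤ R}.Finite := by
  simp only [P.norm_smul_sub_le_iff hδ]
  exact P.finite _ _

/-- Requiring `δ ≤ R` makes the count purely of order `(R / δ) ^ d`, with no additive term. -/
theorem card_le_of_norm_smul_sub_le {δ R : ℝ} (hδ : 0 < δ) (hR : δ ≤ R) {x : Space d}
    {F : Finset (Fin d → ℤ)} (hF : ∀ k ∈ F, ‖δ • P.p k - x‖ ≤ R) :
    (F.card : ℝ) ≤ P.density * (δ⁻¹ * R) ^ d :=
  P.card_le (δ⁻¹ • x) _ (by rwa [le_inv_mul_iff₀ hδ, mul_one])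
    F fun k hk ↦ (P.norm_smul_sub_le_iff hδ).1 (hF k hk)

theorem finite_cut_ne_zero {δ : ℝ} (hδ : 0 < δ) (ψ : TestFn d) :
    {k | P.cut δ k ψ ≠ 0}.Finite := by
  obtain ⟨ρ, -, hρ⟩ := exists_forall_norm_le ψ
  exact (P.finite_norm_smul_sub_le hδ 0 (δ + ρ)).subset
    fun k hk ↦ P.norm_sub_le_of_cut_ne_zero hδ hρ hk

theorem sum_cut {δ : ℝ} {ψ : TestFn d} {F : Finset (Fin d → ℤ)}
    (hF : ∀ k, P.cut δ k ψ ≠ 0 → k ∈ F) : ∑ k ∈ F, P.cut δ k ψ = ψ := by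
  ext y
  let ev : TestFn d →+ ℝ := { toFun := fun φ ↦ φ y, map_zero' := rfl, map_add' := fun _ _ ↦ rfl }
  change ev _ = ψ y
  rw [map_sum]
  change ∑ k ∈ F, P.cell δ k y * ψ y = ψ y
  rw [← Finset.sum_mul]
  by_cases hy : ψ y = 0
  · rw [hy, mul_zero]
  · have h1 : ∑ k ∈ F, P.cell δ k y = 1 := P.sum_eq_one _ _ fun k hk ↦ hF k fun h ↦
      mul_ne_zero hk hy (DFunLike.congr_fun h y)
    rw [h1, one_mul]

/-- Seen at scale `δ' ≤ δ`, a cell of mesh `δ` is a translate of `θ` contracted by `δ' / δ ≤ 1`, so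
the constant depends on neither scale. -/
theorem holderBound_cut {r B B' δ δ' : ℝ} (hr : 0 ≤ r) (hδ' : 0 < δ') (hδ : δ' ≤ δ)
    {ψ : TestFn d} (hP : HolderBound r B P.θ) (hψ : HolderBound r B' fun z ↦ ψ (δ' • z))
    (k : Fin d → ℤ) :
    HolderBound r (2 ^ (⌊r⌋₊ + 2) * B * B') fun z ↦ P.cut δ k ψ (δ' • z) := by
  have h1 := hP.comp_affine hr P.contDiff (a := δ⁻¹ * δ')
    (mul_nonneg (inv_nonneg.2 (hδ'.le.trans hδ)) hδ'.le)
    (by rwa [inv_mul_le_iff₀ (by linarith), mul_one]) (- P.p k)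
  have h2 := h1.mul hr hψ (P.contDiff.comp (by fun_prop)) (ψ.contDiff.comp (by fun_prop))
  convert h2 using 4
  rw [cut_apply, cell, smul_smul, sub_eq_add_neg]

end TranslatePartition

theorem exists_eq_smul_rescale {r B δ : ℝ} (hB : 0 < B) (hδ : 0 < δ) {x : Space d}
    {g : TestFn d} (hg : ∀ y, g y ≠ 0 → ‖y - x‖ ≤ δ) (hr : 0 ≤ r)
    (hgB : HolderBound r B fun z ↦ g (δ • z)) :
    ∃ φ ∈ testBall d r, g = (B * δ ^ d) • rescale φ x δ hδ := by
  have hs : ContDiff ℝ ∞ fun z : Space d ↦ g (δ • z) := g.contDiff.comp (by fun_prop)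
  have hs' : ContDiff ℝ ∞ fun z : Space d ↦ B⁻¹ * g (δ • z + x) :=
    contDiff_const.mul (g.contDiff.comp (by fun_prop))
  have hsupp : tsupport (fun z : Space d ↦ B⁻¹ * g (δ • z + x)) ⊆ Metric.closedBall 0 1 := by
    refine closure_minimal (fun z hz ↦ ?_) Metric.isClosed_closedBall
    have h1 := hg _ (right_ne_zero_of_mul hz)
    rw [add_sub_cancel_right, norm_smul, Real.norm_of_nonneg hδ.le] at h1
    simpa using (mul_le_iff_le_one_right hδ).1 h1
  refine ⟨⟨fun z ↦ B⁻¹ * g (δ • z + x), hs',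
    (isCompact_closedBall _ _).of_isClosed_subset (isClosed_tsupport _) hsupp,
    fun _ _ ↦ trivial⟩, ⟨hsupp, HolderBound.holderNormLeOne ?_⟩, ?_⟩
  · have h1 := (hgB.comp_affine hr hs zero_le_one le_rfl (δ⁻¹ • x)).const_mul
      (hs.comp (by fun_prop)) B⁻¹
    rw [abs_of_pos (inv_pos.2 hB), inv_mul_cancel₀ hB.ne'] at h1
    simp only [one_smul, smul_add, smul_smul δ δ⁻¹, mul_inv_cancel₀ hδ.ne'] at h1
    exact h1
  · ext y
    change g y = (B * δ ^ d) * ((δ ^ d)⁻¹ * (B⁻¹ * g (δ • (δ⁻¹ • (y - x)) + x)))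
    rw [smul_smul, mul_inv_cancel₀ hδ.ne', one_smul, sub_add_cancel]
    have := pow_pos hδ d
    field_simp

/-- Transfers bounds on normalised test functions to arbitrary localised ones; `δ ^ d` undoes the
normalisation in `rescale`. -/
theorem abs_apply_le_of_rescale {r B δ c : ℝ} (hδ : 0 < δ) {x : Space d} {D : Distr d}
    (hD : ∀ φ ∈ testBall d r, |D (rescale φ x δ hδ)| ≤ c)
    {g : TestFn d} (hg : ∀ y, g y ≠ 0 → ‖y - x‖ ≤ δ) (hr : 0 ≤ r)
    (hgB : HolderBound r B fun z ↦ g (δ • z)) : |D g| ≤ B * δ ^ d * c := by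
  -- For `B = 0` division by `B` is impossible, but then `g` vanishes.
  rcases (hgB.nonneg hr).eq_or_lt with hB | hB
  · have : g = 0 := by
      ext y
      have h1 := hgB.1 0 (by simpa using hr) (δ⁻¹ • y)
      rw [norm_iteratedFDeriv_zero, ← hB, smul_smul, mul_inv_cancel₀ hδ.ne', one_smul] at h1
      exact norm_le_zero_iff.1 h1
    rw [this, map_zero, ← hB]
    simp
  · obtain ⟨φ, hφ, rfl⟩ := exists_eq_smul_rescale hB hδ hg hr hgB
    rw [map_smul, smul_eq_mul, abs_mul, abs_of_pos (by positivity)]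
    exact mul_le_mul_of_nonneg_left (hD φ hφ) (by positivity)

theorem norm_sub_le_of_rescale_ne_zero {r : ℝ} {φ : TestFn d} (hφ : φ ∈ testBall d r) {x : Space d}
    {l : ℝ} (hl : 0 < l) {y : Space d} (hy : rescale φ x l hl y ≠ 0) : ‖y - x‖ ≤ l := by
  have h1 := hφ.1 (subset_tsupport _ (right_ne_zero_of_mul hy))
  rw [mem_closedBall_zero_iff, norm_smul, norm_inv, Real.norm_of_nonneg hl.le,
    inv_mul_le_iff₀ hl, mul_one] at h1
  exact h1

theorem holderBound_rescale {r : ℝ} (hr : 0 ≤ r) {φ : TestFn d} (hφ : φ ∈ testBall d r)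
    (x : Space d) {l δ : ℝ} (hl : 0 < l) (hδ : 0 ≤ δ) (hδl : δ ≤ l) :
    HolderBound r (l ^ d)⁻¹ fun z ↦ rescale φ x l hl (δ • z) := by
  have h1 := ((HolderBound.of_holderNormLeOne hφ.2).comp_affine hr φ.contDiff (a := l⁻¹ * δ)
    (by positivity) (by rwa [inv_mul_le_iff₀ hl, mul_one]) (-(l⁻¹ • x))).const_mul
    (φ.contDiff.comp (by fun_prop)) (l ^ d)⁻¹
  rw [mul_one, abs_of_pos (by positivity)] at h1
  simpa only [rescale_apply, sub_eq_add_neg, smul_add, smul_neg, smul_smul] using h1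

/-! ### Uniqueness. -/

/-- A distribution of positive Hölder regularity bounds at every point vanishes. -/
theorem distr_eq_zero {r γ : ℝ} (hr : 0 ≤ r) (hγ : 0 < γ) (D : Distr d)
    (hD : ∀ K : Set (Space d), IsCompact K → ∃ C : ℝ, ∀ x ∈ K, ∀ φ ∈ testBall d r,
      ∀ l : ℝ, ∀ hl : 0 < l, l ≤ 1 → |D (rescale φ x l hl)| ≤ C * l ^ γ) : D = 0 := by
  let P := gridPartition d
  ext ψ
  obtain ⟨ρ, hρ1, hρ⟩ := exists_forall_norm_le ψ
  obtain ⟨C, hC⟩ := hD _ (isCompact_closedBall 0 (1 + ρ))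
  obtain ⟨Bθ, hBθ⟩ := P.exists_holderBound r
  obtain ⟨B, hB⟩ := exists_holderBound r ψ.contDiff ψ.hasCompactSupport
  set E := 2 ^ (⌊r⌋₊ + 2) * Bθ * B with hE
  have hE0 : 0 ≤ E := by have := hBθ.nonneg hr; have := hB.nonneg hr; positivity
  -- There are `O(δ^(-d))` cells meeting the support of `ψ`, each contributing `O(δ^d δ^γ)`.
  have key : ∀ δ : ℝ, 0 < δ → δ ≤ 1 →
      |D ψ| ≤ P.density * (2 * ρ) ^ d * (E * |C|) * δ ^ γ := fun δ hδ hδ1 ↦ by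
    have hfin := P.finite_cut_ne_zero hδ ψ
    have h0 : ∀ k ∈ hfin.toFinset, ‖δ • P.p k - 0‖ ≤ δ + ρ := fun k hk ↦
      P.norm_sub_le_of_cut_ne_zero hδ hρ (hfin.mem_toFinset.1 hk)
    have h1 : ∀ k ∈ hfin.toFinset, |D (P.cut δ k ψ)| ≤ E * δ ^ d * (|C| * δ ^ γ) := fun k hk ↦ by
      refine abs_apply_le_of_rescale hδ (x := δ • P.p k) (fun φ hφ ↦ ?_)
        (fun y hy ↦ P.norm_sub_le_of_cell_ne_zero hδ (left_ne_zero_of_mul hy)) hr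
        (P.holderBound_cut hr hδ le_rfl hBθ ?_ k)
      · refine (hC _ ?_ φ hφ δ hδ hδ1).trans (mul_le_mul_of_nonneg_right (le_abs_self C) (by positivity))
        simpa using (h0 k hk).trans (by linarith)
      · simpa using hB.comp_affine hr ψ.contDiff hδ.le hδ1 0
    have h2 := P.card_le_of_norm_smul_sub_le hδ (by linarith) h0
    calc |D ψ| = |∑ k ∈ hfin.toFinset, D (P.cut δ k ψ)| := by
          rw [← map_sum, P.sum_cut fun k hk ↦ hfin.mem_toFinset.2 hk]
      _ ≤ ∑ k ∈ hfin.toFinset, |D (P.cut δ k ψ)| := Finset.abs_sum_le_sum_abs _ _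
      _ ≤ hfin.toFinset.card * (E * δ ^ d * (|C| * δ ^ γ)) := by
          rw [← nsmul_eq_mul]; exact Finset.sum_le_card_nsmul _ _ _ h1
      _ ≤ P.density * (δ⁻¹ * (2 * ρ)) ^ d * (E * δ ^ d * (|C| * δ ^ γ)) := by
          have := P.density_nonneg
          refine mul_le_mul_of_nonneg_right (h2.trans ?_) (by positivity)
          gcongr
          linarith
      _ = _ := by
          rw [mul_pow, inv_pow]
          have := pow_pos hδ d
          field_simp
  have hlim : Filter.Tendsto
      (fun δ : ℝ ↦ P.density * (2 * ρ) ^ d * (E * |C|) * δ ^ γ) (nhdsWithin 0 (Set.Ioi 0)) (nhds 0) := by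
    have h1 : Filter.Tendsto (fun δ : ℝ ↦ δ ^ γ) (nhdsWithin 0 (Set.Ioi 0)) (nhds 0) := by
      have := (Real.continuousAt_rpow_const 0 γ (Or.inr hγ.le)).tendsto
      rw [Real.zero_rpow hγ.ne'] at this
      exact this.mono_left nhdsWithin_le_nhds
    simpa using h1.const_mul (P.density * (2 * ρ) ^ d * (E * |C|))
  have h0 : |D ψ| ≤ 0 := ge_of_tendsto hlim <| by
    filter_upwards [Ioc_mem_nhdsGT zero_lt_one] with δ hδ using key δ hδ.1 hδ.2
  simpa using h0

/-! ### Gluing a coherent germ along dyadic meshes. -/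

namespace TranslatePartition

variable (P : TranslatePartition d) (F : Space d → Distr d)

/-- The germ `F` glued along the partition of unity at mesh `δ`. -/
noncomputable def glue (δ : ℝ) (ψ : TestFn d) : ℝ := ∑ᶠ k, F (δ • P.p k) (P.cut δ k ψ)

variable {P F}

theorem glue_eq_sum {δ : ℝ} {ψ : TestFn d} {G : Finset (Fin d → ℤ)}
    (hG : ∀ k, P.cut δ k ψ ≠ 0 → k ∈ G) :
    P.glue F δ ψ = ∑ k ∈ G, F (δ • P.p k) (P.cut δ k ψ) :=
  finsum_eq_sum_of_support_subset _ fun k hk ↦ hG k fun h ↦ hk (by simp [h])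

theorem finite_support_glue {δ : ℝ} (hδ : 0 < δ) (ψ : TestFn d) :
    (Function.support fun k ↦ F (δ • P.p k) (P.cut δ k ψ)).Finite :=
  (P.finite_cut_ne_zero hδ ψ).subset fun k hk h ↦ hk (by simp [h])

theorem glue_add {δ : ℝ} (hδ : 0 < δ) (φ ψ : TestFn d) :
    P.glue F δ (φ + ψ) = P.glue F δ φ + P.glue F δ ψ := by
  simp only [glue, map_add]
  exact finsum_add_distrib (finite_support_glue hδ φ) (finite_support_glue hδ ψ)

theorem glue_smul (δ c : ℝ) (ψ : TestFn d) : P.glue F δ (c • ψ) = c * P.glue F δ ψ := by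
  simp only [glue, map_smul, smul_eq_mul]
  exact (mul_finsum _ _).symm

end TranslatePartition

/-- Coherence of the germ `F` on the ball of radius `R` with exponent `γ`. -/
def CoherentOn (r γ C R : ℝ) (F : Space d → Distr d) : Prop :=
  ∀ x y : Space d, ‖x‖ ≤ R → ‖y‖ ≤ R → ∀ δ : ℝ, 0 < δ → δ ≤ 1 → ‖x - y‖ ≤ 4 * δ →
    ∀ (g : TestFn d) (B : ℝ), (∀ z, g z ≠ 0 → ‖z - x‖ ≤ δ) →
      HolderBound r B (fun z ↦ g (δ • z)) → |F x g - F y g| ≤ C * B * δ ^ d * δ ^ γ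

namespace TranslatePartition

variable {P : TranslatePartition d} {F : Space d → Distr d} {r γ C R Bθ B δ ρ : ℝ}

/-- The constant in the product estimate for localised test functions. -/
noncomputable abbrev cutConst (r Bθ : ℝ) : ℝ := 2 ^ (⌊r⌋₊ + 2) * Bθ

theorem abs_glue_half_sub_glue_le (hr : 0 ≤ r) (hγ : 0 < γ) (hC : 0 ≤ C)
    (hF : CoherentOn r γ C (R + 1) F) (hBθ : HolderBound r Bθ P.θ) (hδ : 0 < δ) (hδ1 : δ ≤ 1)
    {x : Space d} (hR : ‖x‖ + ρ ≤ R) (hδρ : δ ≤ ρ) {ψ : TestFn d}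
    (hψ : ∀ y, ψ y ≠ 0 → ‖y - x‖ ≤ ρ) (hψB : HolderBound r B fun z ↦ ψ (δ • z)) :
    |P.glue F (δ / 2) ψ - P.glue F δ ψ| ≤
      P.density ^ 2 * 4 ^ d * C * cutConst r Bθ ^ 2 * B * ρ ^ d * δ ^ γ := by
  have hBθ0 := hBθ.nonneg hr
  have hB0 := hψB.nonneg hr
  have hP0 := P.density_nonneg
  set E := cutConst r Bθ with hE
  have hE0 : 0 ≤ E := by positivity
  set δ' := δ / 2 with hδ'
  have hδ'0 : 0 < δ' := by positivity
  have hJ := P.finite_cut_ne_zero hδ'0 ψ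
  have hI := P.finite_cut_ne_zero hδ ψ
  have hJx : ∀ j ∈ hJ.toFinset, ‖δ' • P.p j - x‖ ≤ δ' + ρ := fun j hj ↦
    P.norm_sub_le_of_cut_ne_zero hδ'0 hψ (hJ.mem_toFinset.1 hj)
  have hIx : ∀ k ∈ hI.toFinset, ‖δ • P.p k - x‖ ≤ δ + ρ := fun k hk ↦
    P.norm_sub_le_of_cut_ne_zero hδ hψ (hI.mem_toFinset.1 hk)
  -- Common refinement: each fine piece is cut again by the coarse partition and each coarse piece
  -- by the fine one, so only differences of `F` at two centres remain.
  have e : P.glue F δ' ψ - P.glue F δ ψ = ∑ j ∈ hJ.toFinset, ∑ k ∈ hI.toFinset,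
      (F (δ' • P.p j) (P.cut δ k (P.cut δ' j ψ)) - F (δ • P.p k) (P.cut δ k (P.cut δ' j ψ))) := by
    simp only [Finset.sum_sub_distrib]
    congr 1
    · rw [glue_eq_sum fun j hj ↦ hJ.mem_toFinset.2 hj]
      refine Finset.sum_congr rfl fun j _ ↦ ?_
      rw [← map_sum, P.sum_cut fun k hk ↦ hI.mem_toFinset.2 fun h ↦ hk ?_]
      rw [P.cut_comm, h, map_zero]
    · rw [glue_eq_sum fun k hk ↦ hI.mem_toFinset.2 hk, Finset.sum_comm]
      refine Finset.sum_congr rfl fun k _ ↦ ?_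
      simp only [P.cut_comm δ δ']
      rw [← map_sum, P.sum_cut fun j hj ↦ hJ.mem_toFinset.2 fun h ↦ hj ?_]
      rw [P.cut_comm, h, map_zero]
  -- Coherence is used at the fine scale, where `2 * δ = 4 * δ'` is exactly the separation allowed
  -- by `CoherentOn`.
  have term : ∀ j ∈ hJ.toFinset, ∀ k ∈ hI.toFinset, ‖δ • P.p k - δ' • P.p j‖ ≤ 2 * δ →
      |F (δ' • P.p j) (P.cut δ k (P.cut δ' j ψ)) - F (δ • P.p k) (P.cut δ k (P.cut δ' j ψ))|
        ≤ C * (E ^ 2 * B) * δ' ^ d * δ ^ γ := fun j hj k hk hjk ↦ by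
    have hn (y : Space d) : ‖y‖ ≤ ‖y - x‖ + ‖x‖ := by simpa using norm_add_le (y - x) x
    have h1 : HolderBound r B fun z ↦ ψ (δ' • z) := by
      have := hψB.comp_affine hr (ψ.contDiff.comp (by fun_prop)) (a := 1 / 2) (by norm_num)
        (by norm_num) 0
      convert this using 3
      rw [add_zero, smul_smul]
      congr 2
      ring
    have h2 := P.holderBound_cut hr hδ'0 (by linarith : δ' ≤ δ) hBθ
      (P.holderBound_cut hr hδ'0 le_rfl hBθ h1 j) k
    refine (hF _ _ ?_ ?_ δ' hδ'0 (by linarith) ?_ _ _ (fun z hz ↦ ?_) h2).trans ?_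
    · linarith [hn (δ' • P.p j), hJx j hj]
    · linarith [hn (δ • P.p k), hIx k hk]
    · rw [norm_sub_rev]; linarith
    · exact P.norm_sub_le_of_cell_ne_zero hδ'0 (left_ne_zero_of_mul (right_ne_zero_of_mul hz))
    · rw [show 2 ^ (⌊r⌋₊ + 2) * Bθ * (2 ^ (⌊r⌋₊ + 2) * Bθ * B) = E ^ 2 * B by
        rw [hE, cutConst]; ring]
      gcongr
      linarith
  have inner : ∀ j ∈ hJ.toFinset, |∑ k ∈ hI.toFinset, (F (δ' • P.p j) (P.cut δ k (P.cut δ' j ψ))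
      - F (δ • P.p k) (P.cut δ k (P.cut δ' j ψ)))|
      ≤ P.density * 2 ^ d * (C * (E ^ 2 * B) * δ' ^ d * δ ^ γ) := fun j hj ↦ by
    classical
    -- Only overlapping cells contribute, so each fine cell interacts with a number of coarse cells
    -- bounded independently of `δ`.
    have hsub : ∑ k ∈ hI.toFinset, (F (δ' • P.p j) (P.cut δ k (P.cut δ' j ψ))
        - F (δ • P.p k) (P.cut δ k (P.cut δ' j ψ)))
        = ∑ k ∈ hI.toFinset with ‖δ • P.p k - δ' • P.p j‖ ≤ 2 * δ,
          (F (δ' • P.p j) (P.cut δ k (P.cut δ' j ψ))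
            - F (δ • P.p k) (P.cut δ k (P.cut δ' j ψ))) := by
      refine (Finset.sum_filter_of_ne fun k _ hne ↦ ?_).symm
      have h1 : P.cut δ k (P.cut δ' j ψ) ≠ 0 := fun h ↦ hne (by simp [h])
      have h2 := P.norm_sub_le_of_cut_ne_zero hδ (x := δ' • P.p j) (ρ := δ')
        (fun y hy ↦ P.norm_sub_le_of_cell_ne_zero hδ'0 (left_ne_zero_of_mul hy)) h1
      linarith
    rw [hsub]
    have hcard := P.card_le_of_norm_smul_sub_le hδ (by linarith : δ ≤ 2 * δ)
      (x := δ' • P.p j) (F := {k ∈ hI.toFinset | ‖δ • P.p k - δ' • P.p j‖ ≤ 2 * δ})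
      fun k hk ↦ (Finset.mem_filter.1 hk).2
    rw [show δ⁻¹ * (2 * δ) = 2 by field_simp] at hcard
    refine (Finset.abs_sum_le_sum_abs _ _).trans <| (Finset.sum_le_card_nsmul _ _ _ fun k hk ↦
      term j hj k (Finset.mem_filter.1 hk).1 (Finset.mem_filter.1 hk).2).trans ?_
    rw [nsmul_eq_mul]
    exact mul_le_mul_of_nonneg_right hcard (by positivity)
  have hcard := P.card_le_of_norm_smul_sub_le hδ'0 (by linarith) hJx
  rw [e]
  refine (Finset.abs_sum_le_sum_abs _ _).trans <|
    (Finset.sum_le_card_nsmul _ _ _ inner).trans ?_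
  rw [nsmul_eq_mul]
  calc _ ≤ P.density * (δ'⁻¹ * (2 * ρ)) ^ d *
        (P.density * 2 ^ d * (C * (E ^ 2 * B) * δ' ^ d * δ ^ γ)) := by
        refine mul_le_mul_of_nonneg_right (hcard.trans ?_) (by positivity)
        have hρ0 : 0 ≤ ρ := hδ.le.trans hδρ
        gcongr
        linarith
    _ = _ := by
        have := pow_pos hδ'0 d
        rw [mul_pow, mul_pow, inv_pow, show (4 : ℝ) ^ d = 2 ^ d * 2 ^ d by rw [← mul_pow]; norm_num]
        field_simp

/-- When the mesh is comparable to the radius of the support, boundedly many cells matter, all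
centred within `3 * δ` of `x`, so coherence compares each with `F x`. -/
theorem abs_glue_sub_le (hr : 0 ≤ r) (hC : 0 ≤ C)
    (hF : CoherentOn r γ C (R + 1) F) (hBθ : HolderBound r Bθ P.θ) (hδ : 0 < δ) (hδ1 : δ ≤ 1)
    {x : Space d} (hR : ‖x‖ + ρ ≤ R) (hδρ : δ ≤ ρ) (hρδ : ρ ≤ 2 * δ) {ψ : TestFn d}
    (hψ : ∀ y, ψ y ≠ 0 → ‖y - x‖ ≤ ρ) (hψB : HolderBound r B fun z ↦ ψ (δ • z)) :
    |P.glue F δ ψ - F x ψ| ≤ P.density * 3 ^ d * C * cutConst r Bθ * B * δ ^ d * δ ^ γ := by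
  have hBθ0 := hBθ.nonneg hr
  have hB0 := hψB.nonneg hr
  have hP0 := P.density_nonneg
  set E := cutConst r Bθ with hE
  have hE0 : 0 ≤ E := by positivity
  have hI := P.finite_cut_ne_zero hδ ψ
  have hIx : ∀ k ∈ hI.toFinset, ‖δ • P.p k - x‖ ≤ δ + ρ := fun k hk ↦
    P.norm_sub_le_of_cut_ne_zero hδ hψ (hI.mem_toFinset.1 hk)
  have e : P.glue F δ ψ - F x ψ = ∑ k ∈ hI.toFinset,
      (F (δ • P.p k) (P.cut δ k ψ) - F x (P.cut δ k ψ)) := by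
    rw [Finset.sum_sub_distrib, ← map_sum, P.sum_cut fun k hk ↦ hI.mem_toFinset.2 hk,
      glue_eq_sum fun k hk ↦ hI.mem_toFinset.2 hk]
  have term : ∀ k ∈ hI.toFinset, |F (δ • P.p k) (P.cut δ k ψ) - F x (P.cut δ k ψ)|
      ≤ C * (E * B) * δ ^ d * δ ^ γ := fun k hk ↦ by
    refine hF _ _ ?_ ?_ δ hδ hδ1 ?_ _ _
      (fun z hz ↦ P.norm_sub_le_of_cell_ne_zero hδ (left_ne_zero_of_mul hz))
      (P.holderBound_cut hr hδ le_rfl hBθ hψB k)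
    · have : ‖δ • P.p k‖ ≤ ‖δ • P.p k - x‖ + ‖x‖ := by simpa using norm_add_le (δ • P.p k - x) x
      linarith [hIx k hk]
    · linarith
    · linarith [hIx k hk]
  have hcard := P.card_le_of_norm_smul_sub_le hδ (by linarith : δ ≤ 3 * δ)
    (x := x) (F := hI.toFinset) fun k hk ↦ (hIx k hk).trans (by linarith)
  rw [show δ⁻¹ * (3 * δ) = 3 by field_simp] at hcard
  rw [e]
  refine (Finset.abs_sum_le_sum_abs _ _).trans <|
    (Finset.sum_le_card_nsmul _ _ _ term).trans ?_
  rw [nsmul_eq_mul]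
  refine (mul_le_mul_of_nonneg_right hcard (by positivity)).trans (le_of_eq ?_)
  ring

end TranslatePartition

namespace TranslatePartition

variable {P : TranslatePartition d} {F : Space d → Distr d} {r γ C R Bθ B ρ : ℝ}

/-- Increments decay geometrically with ratio `(1 / 2) ^ γ`. Starting at an arbitrary level `m`
serves both convergence (`m = 0`) and the bound at scale `(1 / 2) ^ m`. -/
theorem dist_glue_succ_le (hr : 0 ≤ r) (hγ : 0 < γ) (hC : 0 ≤ C)
    (hF : CoherentOn r γ C (R + 1) F) (hBθ : HolderBound r Bθ P.θ)
    {x : Space d} (hR : ‖x‖ + ρ ≤ R) {m : ℕ} (hm : (1 / 2) ^ m ≤ ρ) {ψ : TestFn d}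
    (hψ : ∀ y, ψ y ≠ 0 → ‖y - x‖ ≤ ρ)
    (hψB : HolderBound r B fun z ↦ ψ (((1 / 2 : ℝ) ^ m) • z)) (n : ℕ) :
    dist (P.glue F ((1 / 2) ^ (m + n)) ψ) (P.glue F ((1 / 2) ^ (m + (n + 1))) ψ) ≤
      P.density ^ 2 * 4 ^ d * C * cutConst r Bθ ^ 2 * B * ρ ^ d * ((1 / 2) ^ m) ^ γ
        * ((1 / 2 : ℝ) ^ γ) ^ n := by
  have hs : (1 / 2 : ℝ) ^ (m + n) = (1 / 2) ^ n * (1 / 2) ^ m := by rw [pow_add, mul_comm]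
  have hn : (1 / 2 : ℝ) ^ n ≤ 1 := pow_le_one₀ (by norm_num) (by norm_num)
  have h1 : HolderBound r B fun z ↦ ψ (((1 / 2 : ℝ) ^ (m + n)) • z) := by
    have := hψB.comp_affine hr (ψ.contDiff.comp (by fun_prop)) (a := (1 / 2) ^ n) (by positivity)
      hn 0
    simpa only [add_zero, smul_smul, ← pow_add] using this
  have h2 := abs_glue_half_sub_glue_le hr hγ hC hF hBθ (δ := (1 / 2) ^ (m + n)) (by positivity)
    (pow_le_one₀ (by norm_num) (by norm_num)) hR
    (by rw [hs]; exact (mul_le_of_le_one_left (by positivity) hn).trans hm) hψ h1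
  rw [dist_comm, Real.dist_eq, ← add_assoc, pow_succ, mul_one_div]
  refine h2.trans (le_of_eq ?_)
  rw [hs, Real.mul_rpow (by positivity) (by positivity),
    Real.rpow_pow_comm (by norm_num : (0 : ℝ) ≤ 1 / 2)]
  ring

theorem half_rpow_lt_one (hγ : 0 < γ) : (1 / 2 : ℝ) ^ γ < 1 :=
  Real.rpow_lt_one (by norm_num) (by norm_num) hγ

theorem exists_tendsto_glue (hr : 0 ≤ r) (hγ : 0 < γ)
    (hF : ∀ R, ∃ C, 0 ≤ C ∧ CoherentOn r γ C R F) (ψ : TestFn d) :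
    ∃ a, Filter.Tendsto (fun n : ℕ ↦ P.glue F ((1 / 2) ^ n) ψ) Filter.atTop (nhds a) := by
  obtain ⟨ρ, hρ1, hρ⟩ := exists_forall_norm_le ψ
  obtain ⟨C, hC, hF⟩ := hF (ρ + 1)
  obtain ⟨Bθ, hBθ⟩ := P.exists_holderBound r
  obtain ⟨B, hB⟩ := RegStruct.exists_holderBound r ψ.contDiff ψ.hasCompactSupport
  have h := dist_glue_succ_le hr hγ hC hF hBθ (x := 0) (m := 0) (by simp) (by simpa) hρ
    (B := B) (by simpa using hB)
  simp only [zero_add] at h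
  exact cauchySeq_tendsto_of_complete (cauchySeq_of_le_geometric _ _ (half_rpow_lt_one hγ) h)

theorem abs_glue_sub_limit_le (hr : 0 ≤ r) (hγ : 0 < γ) (hC : 0 ≤ C)
    (hF : CoherentOn r γ C (R + 1) F) (hBθ : HolderBound r Bθ P.θ)
    {x : Space d} (hR : ‖x‖ + ρ ≤ R) {m : ℕ} (hm : (1 / 2) ^ m ≤ ρ) {ψ : TestFn d}
    (hψ : ∀ y, ψ y ≠ 0 → ‖y - x‖ ≤ ρ)
    (hψB : HolderBound r B fun z ↦ ψ (((1 / 2 : ℝ) ^ m) • z)) {a : ℝ}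
    (ha : Filter.Tendsto (fun n : ℕ ↦ P.glue F ((1 / 2) ^ n) ψ) Filter.atTop (nhds a)) :
    |P.glue F ((1 / 2) ^ m) ψ - a| ≤ P.density ^ 2 * 4 ^ d * C * cutConst r Bθ ^ 2 * B * ρ ^ d
      * ((1 / 2) ^ m) ^ γ / (1 - (1 / 2) ^ γ) := by
  have ha' : Filter.Tendsto (fun n : ℕ ↦ P.glue F ((1 / 2) ^ (m + n)) ψ) Filter.atTop (nhds a) := by
    simpa only [add_comm m] using (Filter.tendsto_add_atTop_iff_nat m).2 ha
  exact dist_le_of_le_geometric_of_tendsto₀ _ _ (half_rpow_lt_one hγ)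
    (dist_glue_succ_le hr hγ hC hF hBθ hR hm hψ hψB) ha'

/-- At mesh `1` only finitely many centres see the ball of radius `ρ`, so bounds on `F x` with no
uniformity in `x` suffice. -/
theorem exists_abs_glue_one_le (hr : 0 ≤ r)
    (hloc : ∀ x, ∃ C, ∀ (g : TestFn d) (B : ℝ), (∀ y, g y ≠ 0 → ‖y - x‖ ≤ 1) →
      HolderBound r B g → |F x g| ≤ C * B) (ρ : ℝ) :
    ∃ M, 0 ≤ M ∧ ∀ (ψ : TestFn d) (B : ℝ), (∀ y, ψ y ≠ 0 → ‖y - 0‖ ≤ ρ) → HolderBound r B ψ →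
      |P.glue F 1 ψ| ≤ M * B := by
  obtain ⟨Bθ, hBθ⟩ := P.exists_holderBound r
  have hE := (hBθ.nonneg hr)
  choose C hC using hloc
  have hfin := P.finite_norm_smul_sub_le zero_lt_one (0 : Space d) (1 + ρ)
  refine ⟨∑ k ∈ hfin.toFinset, |C ((1 : ℝ) • P.p k)| * cutConst r Bθ, Finset.sum_nonneg
    fun _ _ ↦ by positivity, fun ψ B hψ hB ↦ ?_⟩
  have hB0 := hB.nonneg hr
  rw [glue_eq_sum fun k hk ↦
    hfin.mem_toFinset.2 (P.norm_sub_le_of_cut_ne_zero zero_lt_one hψ hk), Finset.sum_mul]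
  refine (Finset.abs_sum_le_sum_abs _ _).trans (Finset.sum_le_sum fun k _ ↦ ?_)
  have h1 := P.holderBound_cut hr zero_lt_one le_rfl hBθ (B' := B) (ψ := ψ) (by simpa using hB) k
  simp only [one_smul] at h1
  refine (hC _ _ _ (fun y hy ↦ P.norm_sub_le_of_cell_ne_zero zero_lt_one
    (left_ne_zero_of_mul hy)) h1).trans ?_
  refine (mul_le_mul_of_nonneg_right (le_abs_self _) (by positivity)).trans (le_of_eq ?_)
  rw [cutConst]
  ring

end TranslatePartition

/-! ### Reconstruction of coherent germs. -/

open TranslatePartition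

/-- A linear functional on test functions bounded by the `C^r` norm on every ball is continuous. -/
theorem continuous_of_holderBound (r : ℝ) (L : TestFn d →ₗ[ℝ] ℝ)
    (hL : ∀ ρ : ℝ, 1 ≤ ρ → ∃ M, 0 ≤ M ∧ ∀ (ψ : TestFn d) (B : ℝ), (∀ y, ψ y ≠ 0 → ‖y - 0‖ ≤ ρ) →
      HolderBound r B ψ → |L ψ| ≤ M * B) : Continuous L := by
  refine (TestFunction.continuous_iff_continuous_comp L).2 fun K hK ↦ ?_
  obtain ⟨ρ, hρ⟩ := K.isCompact.isBounded.exists_norm_le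
  obtain ⟨M, hM, hLM⟩ := hL (max 1 ρ) (le_max_left _ _)
  refine (ContDiffMapSupportedIn.mkCLMtoNormedSpace (𝕜 := ℝ)
    (L ∘ TestFunction.ofSupportedIn hK)
    (fun f g ↦ L.map_add (TestFunction.ofSupportedIn hK f) (TestFunction.ofSupportedIn hK g))
    (fun c f ↦ L.map_smul c (TestFunction.ofSupportedIn hK f))
    -- Derivatives up to order `⌊r⌋₊ + 1` control the `C^r` norm with constant `2`, by
    -- `holderBound_of_norm_iteratedFDeriv_le`.
    ⟨Finset.range (⌊r⌋₊ + 2), M * 2, by positivity, fun f ↦ ?_⟩).continuous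
  rw [mul_assoc]
  refine hLM (TestFunction.ofSupportedIn hK f) _ (fun y hy ↦ ?_)
    (holderBound_of_norm_iteratedFDeriv_le f.contDiff fun k hk y ↦ ?_)
  · rw [sub_zero]
    exact (hρ y (f.support_subset hy)).trans (le_max_right _ _)
  · refine (ContDiffMapSupportedIn.norm_iteratedFDeriv_apply_le_seminorm_top ℝ).trans ?_
    exact Seminorm.le_def.1 (Finset.le_sup (f := fun i ↦
      ContDiffMapSupportedIn.seminorm ℝ (Space d) ℝ ⊤ K i) (Finset.mem_range.2 (by omega))) f

theorem exists_half_pow_le {l : ℝ} (hl : 0 < l) (hl1 : l ≤ 1) :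
    ∃ m : ℕ, (1 / 2 : ℝ) ^ m ≤ l ∧ l ≤ 2 * (1 / 2) ^ m := by
  obtain ⟨n, hn, hn'⟩ := exists_nat_pow_near_of_lt_one hl hl1 (by norm_num : (0 : ℝ) < 1 / 2)
    (by norm_num)
  exact ⟨n + 1, hn.le, hn'.trans (by rw [pow_succ]; linarith)⟩

/-- Reconstruction of a coherent germ of positive exponent. -/
theorem exists_distr_of_coherentOn {r γ : ℝ} (hr : 0 ≤ r) (hγ : 0 < γ) {F : Space d → Distr d}
    (hF : ∀ R, ∃ C, 0 ≤ C ∧ CoherentOn r γ C R F)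
    (hloc : ∀ x, ∃ C, ∀ (g : TestFn d) (B : ℝ), (∀ y, g y ≠ 0 → ‖y - x‖ ≤ 1) →
      HolderBound r B g → |F x g| ≤ C * B) :
    ∃ D : Distr d, ∀ K : Set (Space d), IsCompact K → ∃ C : ℝ, ∀ x ∈ K, ∀ φ ∈ testBall d r,
      ∀ l : ℝ, ∀ hl : 0 < l, l ≤ 1 → |(D - F x) (rescale φ x l hl)| ≤ C * l ^ γ := by
  let P := gridPartition d
  have hP0 := P.density_nonneg
  have hq : 0 < 1 - (1 / 2 : ℝ) ^ γ := sub_pos.2 (half_rpow_lt_one hγ)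
  obtain ⟨Bθ, hBθ⟩ := P.exists_holderBound r
  have hBθ0 := hBθ.nonneg hr
  choose L hL using exists_tendsto_glue (P := P) hr hγ hF
  let L' : TestFn d →ₗ[ℝ] ℝ :=
    { toFun := L
      map_add' := fun φ ψ ↦ tendsto_nhds_unique (hL (φ + ψ)) <| by
        simpa only [glue_add (show (0 : ℝ) < (1 / 2) ^ _ by positivity)] using (hL φ).add (hL ψ)
      map_smul' := fun c ψ ↦ tendsto_nhds_unique (hL (c • ψ)) <| by
        simpa only [glue_smul, RingHom.id_apply, smul_eq_mul] using (hL ψ).const_mul c }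
  have hcont : Continuous L' := by
    refine continuous_of_holderBound r L' fun ρ hρ1 ↦ ?_
    obtain ⟨C, hC, hFC⟩ := hF (ρ + 1)
    obtain ⟨M, hM, hM'⟩ := exists_abs_glue_one_le (P := P) hr hloc ρ
    -- The glued value at mesh `1`, plus the whole geometric series of increments.
    refine ⟨M + P.density ^ 2 * 4 ^ d * C * cutConst r Bθ ^ 2 * ρ ^ d / (1 - (1 / 2) ^ γ),
      by positivity, fun ψ B hψ hB ↦ ?_⟩
    have h1 := abs_glue_sub_limit_le hr hγ hC hFC hBθ (x := 0) (m := 0) (by simp) (by simpa) hψ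
      (B := B) (by simpa using hB) (hL ψ)
    simp only [pow_zero, Real.one_rpow, mul_one] at h1
    have h2 : |L ψ| ≤ |P.glue F 1 ψ| + |P.glue F 1 ψ - L ψ| := by
      have := abs_sub_abs_le_abs_sub (L ψ) (P.glue F 1 ψ)
      rw [abs_sub_comm] at this
      linarith
    refine h2.trans ((add_le_add (hM' ψ B hψ hB) h1).trans (le_of_eq ?_))
    ring
  let D : Distr d := TestFunction.mkCLM ℝ L L'.map_add L'.map_smul
    ((TestFunction.continuous_iff_continuous_comp L').1 hcont)
  refine ⟨D, fun K hK ↦ ?_⟩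
  obtain ⟨R, hR⟩ := hK.isBounded.exists_norm_le
  obtain ⟨C, hC, hFC⟩ := hF (R + 1 + 1)
  refine ⟨P.density ^ 2 * 4 ^ d * C * cutConst r Bθ ^ 2 / (1 - (1 / 2) ^ γ)
    + P.density * 3 ^ d * C * cutConst r Bθ, fun x hx φ hφ l hl hl1 ↦ ?_⟩
  -- The dyadic mesh `δ` satisfies `δ ≤ l ≤ 2 * δ`, so both comparison lemmas apply with `ρ = l` and
  -- `B = (l ^ d)⁻¹`.
  obtain ⟨m, hm, hm'⟩ := exists_half_pow_le hl hl1
  set δ : ℝ := (1 / 2) ^ m with hδ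
  have hδ0 : 0 < δ := by positivity
  have hδ1 : δ ≤ 1 := hm.trans hl1
  set ψ := rescale φ x l hl
  have hψ : ∀ y, ψ y ≠ 0 → ‖y - x‖ ≤ l := fun y hy ↦ norm_sub_le_of_rescale_ne_zero hφ hl hy
  have hψB := holderBound_rescale hr hφ x hl hδ0.le hm
  have hRx : ‖x‖ + l ≤ R + 1 := add_le_add (hR x hx) hl1
  have h1 := abs_glue_sub_limit_le hr hγ hC hFC hBθ hRx hm hψ hψB (hL ψ)
  rw [← hδ] at h1
  have h2 := abs_glue_sub_le hr hC hFC hBθ hδ0 hδ1 hRx hm hm' hψ hψB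
  have hl0 := pow_pos hl d
  have h3 : δ ^ γ ≤ l ^ γ := Real.rpow_le_rpow hδ0.le hm hγ.le
  have h4 : (l ^ d)⁻¹ * δ ^ d ≤ 1 := by
    rw [inv_mul_le_iff₀ hl0, mul_one]
    exact pow_le_pow_left₀ hδ0.le hm d
  change |L ψ - F x ψ| ≤ _
  calc |L ψ - F x ψ| ≤ |P.glue F δ ψ - L ψ| + |P.glue F δ ψ - F x ψ| := by
        rw [abs_sub_comm (P.glue F δ ψ)]
        exact abs_sub_le _ _ _
    _ ≤ P.density ^ 2 * 4 ^ d * C * cutConst r Bθ ^ 2 / (1 - (1 / 2) ^ γ) * δ ^ γ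
        + P.density * 3 ^ d * C * cutConst r Bθ * δ ^ γ := by
      refine add_le_add (h1.trans (le_of_eq ?_)) (h2.trans ?_)
      · field_simp
      · calc _ = P.density * 3 ^ d * C * cutConst r Bθ * δ ^ γ * ((l ^ d)⁻¹ * δ ^ d) := by ring
          _ ≤ _ := mul_le_of_le_one_right (by positivity) h4
    _ ≤ _ := by
      rw [← add_mul]
      gcongr

/-! ### Coherence of modelled distributions. -/

namespace RegularityStructure

variable (S : RegularityStructure.{u})

/-- Bolzano–Weierstrass: an infinite set of homogeneities in a bounded interval would accumulate.
Hence sums over `α < γ` are finite. -/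
theorem finite_lt (γ : ℝ) : {α : S.A | (α : ℝ) < γ}.Finite := by
  obtain ⟨b, hb⟩ := S.bddBelow
  have h : (S.A ∩ Set.Iio γ).Finite := by
    by_contra hinf
    obtain ⟨x, -, hx⟩ := Set.Infinite.exists_accPt_of_subset_isCompact hinf
      (isCompact_Icc (a := b) (b := γ)) fun a ha ↦ ⟨hb ha.1, ha.2.le⟩
    exact S.no_accPt x (hx.mono (Filter.principal_mono.2 Set.inter_subset_left))
  exact (h.preimage Subtype.val_injective.injOn).subset fun α hα ↦ ⟨α.2, hα⟩

/-- The homogeneities below `γ`. -/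
noncomputable def below (γ : ℝ) : Finset S.A := (S.finite_lt γ).toFinset

variable {S}

@[simp]
theorem mem_below {γ : ℝ} {α : S.A} : α ∈ S.below γ ↔ (α : ℝ) < γ :=
  (S.finite_lt γ).mem_toFinset

theorem sum_incl {γ : ℝ} {τ : S.ModelSpace} (hτ : ∀ α : S.A, γ ≤ (α : ℝ) → τ α = 0) :
    ∑ α ∈ S.below γ, S.incl α (τ α) = τ := by
  classical
  ext β
  change DirectSum.component ℝ S.A S.T β _ = _
  rw [map_sum]
  by_cases hβ : (β : ℝ) < γ
  · rw [Finset.sum_eq_single_of_mem β (mem_below.2 hβ)]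
    · exact DirectSum.component.lof_self ..
    · intro α _ hα
      rw [DirectSum.component.of, dif_neg hα]
  · rw [hτ β (not_lt.1 hβ)]
    refine Finset.sum_eq_zero fun α hα ↦ ?_
    rw [DirectSum.component.of, dif_neg]
    rintro rfl
    exact hβ (mem_below.1 hα)

/-- By triangularity the structure group preserves `T_{<γ}`, so `f x - Γ_xy (f y)` has no components
at or above `γ`. -/
theorem apply_eq_zero_of_mem {γ : ℝ} {τ : S.ModelSpace} (hτ : ∀ α : S.A, γ ≤ (α : ℝ) → τ α = 0)
    (Γ : S.G) (β : S.A) (hβ : γ ≤ (β : ℝ)) :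
    (Γ : S.ModelSpace ≃ₗ[ℝ] S.ModelSpace) τ β = 0 := by
  rw [← sum_incl hτ, map_sum]
  change DirectSum.component ℝ S.A S.T β _ = _
  rw [map_sum]
  refine Finset.sum_eq_zero fun α hα ↦ ?_
  have hαβ : (α : ℝ) < β := (mem_below.1 hα).trans_le hβ
  have h1 : DirectSum.component ℝ S.A S.T β
      ((Γ : S.ModelSpace ≃ₗ[ℝ] S.ModelSpace) (S.incl α (τ α)) - S.incl α (τ α)) = 0 :=
    S.triangular Γ Γ.2 α (τ α) β fun h ↦ hαβ.not_gt h
  rw [map_sub, sub_eq_zero] at h1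
  rw [h1, DirectSum.component.of, dif_neg]
  rintro rfl
  exact hαβ.false

end RegularityStructure

open RegularityStructure

variable {S : RegularityStructure.{u}} {d : ℕ} {r : ℝ}

theorem Model.exists_abs_Pi_le (hr : 0 ≤ r) (M : Model S d r) {K : Set (Space d)} (hK : IsCompact K)
    {γ : ℝ} (hγ : 0 < γ) : ∃ C : ℝ, 0 ≤ C ∧ ∀ x ∈ K, ∀ τ : S.ModelSpace,
      (∀ α : S.A, γ ≤ (α : ℝ) → τ α = 0) → ∀ δ : ℝ, 0 < δ → δ ≤ 1 → ∀ (g : TestFn d) (B : ℝ),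
        (∀ y, g y ≠ 0 → ‖y - x‖ ≤ δ) → HolderBound r B (fun z ↦ g (δ • z)) →
          |M.Pi x τ g| ≤ C * B * δ ^ d * ∑ α ∈ S.below γ, δ ^ (α : ℝ) * ‖τ α‖ := by
  obtain ⟨C, hC, -⟩ := M.bounds K hK γ hγ
  refine ⟨|C|, abs_nonneg C, fun x hx τ hτ δ hδ hδ1 g B hg hB ↦ ?_⟩
  have hB0 := hB.nonneg hr
  let ev : Distr d →+ ℝ := { toFun := fun D ↦ D g, map_zero' := rfl, map_add' := fun _ _ ↦ rfl }
  have e : M.Pi x τ g = ∑ α ∈ S.below γ, M.Pi x (S.incl α (τ α)) g := by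
    conv_lhs => rw [← sum_incl hτ, map_sum]
    exact map_sum ev _ _
  rw [e, Finset.mul_sum]
  refine (Finset.abs_sum_le_sum_abs _ _).trans (Finset.sum_le_sum fun α hα ↦ ?_)
  refine (abs_apply_le_of_rescale hδ (c := |C| * δ ^ (α : ℝ) * ‖τ α‖) (fun φ hφ ↦ ?_)
    hg hr hB).trans (le_of_eq (by ring))
  refine (hC φ hφ x hx δ hδ hδ1 α (mem_below.1 hα).le (τ α)).trans ?_
  have : 0 < δ ^ (α : ℝ) := Real.rpow_pos_of_pos hδ _
  gcongr
  exact le_abs_self C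

theorem coherentOn_modelled (hr : 0 ≤ r) (M : Model S d r) {γ : ℝ} (hγ : 0 < γ) (f : Dgamma M γ)
    (R : ℝ) : ∃ C, 0 ≤ C ∧
      CoherentOn r γ C R fun x ↦ M.Pi x ((f : Space d → S.ModelSpace) x) := by
  obtain ⟨C, hC, hPi⟩ := M.exists_abs_Pi_le hr (isCompact_closedBall (0 : Space d) R) hγ
  have hf := fun α : S.A ↦ f.2.2 _ (isCompact_closedBall (0 : Space d) R) α
  choose C' hC' using hf
  classical
  -- The factor `4 ^ (γ - α)` comes from `‖x - y‖ ≤ 4 * δ`.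
  let c : S.A → ℝ := fun α ↦ if h : (α : ℝ) < γ then |C' α h| * 4 ^ (γ - α) else 0
  have hc (α : S.A) : 0 ≤ c α := by
    simp only [c]
    split_ifs <;> positivity
  refine ⟨C * ∑ α ∈ S.below γ, c α, mul_nonneg hC (Finset.sum_nonneg fun α _ ↦ hc α),
    fun x y hx hy δ hδ hδ1 hxy g B hg hB ↦ ?_⟩
  have hB0 := hB.nonneg hr
  set h := (f : Space d → S.ModelSpace) x
    - (M.Gam x y : S.ModelSpace ≃ₗ[ℝ] S.ModelSpace) ((f : Space d → S.ModelSpace) y) with hh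
  have hγh (α : S.A) (hα : γ ≤ (α : ℝ)) : h α = 0 := by
    rw [hh, DirectSum.sub_apply, f.2.1 x α hα, apply_eq_zero_of_mem (f.2.1 y) _ α hα, sub_zero]
  have e : M.Pi x ((f : Space d → S.ModelSpace) x) g - M.Pi y ((f : Space d → S.ModelSpace) y) g
      = M.Pi x h g := by
    rw [← M.Pi_Gam x y, hh, map_sub]
    rfl
  have hx' : x ∈ Metric.closedBall (0 : Space d) R := by simpa using hx
  have hy' : y ∈ Metric.closedBall (0 : Space d) R := by simpa using hy
  change |M.Pi x ((f : Space d → S.ModelSpace) x) g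
    - M.Pi y ((f : Space d → S.ModelSpace) y) g| ≤ _
  rw [e]
  have hsum : ∑ α ∈ S.below γ, δ ^ (α : ℝ) * ‖h α‖ ≤ (∑ α ∈ S.below γ, c α) * δ ^ γ := by
    rw [Finset.sum_mul]
    refine Finset.sum_le_sum fun α hα ↦ ?_
    have hα' := mem_below.1 hα
    have hexp : 0 ≤ γ - α := by linarith
    have hpos : 0 < δ ^ (α : ℝ) := Real.rpow_pos_of_pos hδ _
    calc δ ^ (α : ℝ) * ‖h α‖ ≤ δ ^ (α : ℝ) * (|C' α hα'| * (4 * δ) ^ (γ - α)) := by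
          refine mul_le_mul_of_nonneg_left ((hC' α hα' x hx' y hy').trans ?_) hpos.le
          gcongr
          exact le_abs_self _
      _ = c α * (δ ^ (α : ℝ) * δ ^ (γ - α)) := by
          simp only [c, dif_pos hα']
          rw [Real.mul_rpow (by norm_num) hδ.le]
          ring
      _ = c α * δ ^ γ := by rw [← Real.rpow_add hδ, add_sub_cancel]
  refine (hPi x hx' h hγh δ hδ hδ1 g B hg hB).trans ?_
  calc _ ≤ C * B * δ ^ d * ((∑ α ∈ S.below γ, c α) * δ ^ γ) :=
        mul_le_mul_of_nonneg_left hsum (by positivity)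
    _ = _ := by ring

theorem exists_reconstruction (hr : 0 ≤ r) (M : Model S d r) {γ : ℝ} (hγ : 0 < γ)
    (f : Dgamma M γ) : ∃ D : Distr d, ∀ K : Set (Space d), IsCompact K →
      ∃ C : ℝ, ∀ x ∈ K, ∀ φ ∈ testBall d r, ∀ l : ℝ, ∀ hl : 0 < l, l ≤ 1 →
        |(D - M.Pi x ((f : Space d → S.ModelSpace) x)) (rescale φ x l hl)| ≤ C * l ^ γ := by
  refine exists_distr_of_coherentOn hr hγ (coherentOn_modelled hr M hγ f) fun x ↦ ?_
  obtain ⟨C, -, hC⟩ := M.exists_abs_Pi_le hr (isCompact_singleton (x := x)) hγ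
  refine ⟨C * ∑ α ∈ S.below γ, ‖(f : Space d → S.ModelSpace) x α‖, fun g B hg hB ↦ ?_⟩
  have := hC x rfl _ (f.2.1 x) 1 zero_lt_one le_rfl g B hg (by simpa using hB)
  simp only [one_pow, mul_one, Real.one_rpow, one_mul] at this
  exact this.trans (le_of_eq (by ring))

/-- The germ cancels in the difference of two candidates. An arbitrary germ is allowed so that
additivity and homogeneity of the reconstruction are instances as well. -/
theorem reconstruction_unique (hr : 0 ≤ r) {γ : ℝ} (hγ : 0 < γ) {F : Space d → Distr d}
    {D D' : Distr d}
    (hD : ∀ K : Set (Space d), IsCompact K → ∃ C : ℝ, ∀ x ∈ K, ∀ φ ∈ testBall d r,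
      ∀ l : ℝ, ∀ hl : 0 < l, l ≤ 1 → |(D - F x) (rescale φ x l hl)| ≤ C * l ^ γ)
    (hD' : ∀ K : Set (Space d), IsCompact K → ∃ C : ℝ, ∀ x ∈ K, ∀ φ ∈ testBall d r,
      ∀ l : ℝ, ∀ hl : 0 < l, l ≤ 1 → |(D' - F x) (rescale φ x l hl)| ≤ C * l ^ γ) : D = D' := by
  refine sub_eq_zero.1 (distr_eq_zero hr hγ _ fun K hK ↦ ?_)
  obtain ⟨C, hC⟩ := hD K hK
  obtain ⟨C', hC'⟩ := hD' K hK
  refine ⟨C + C', fun x hx φ hφ l hl hl1 ↦ ?_⟩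
  have e : D - D' = (D - F x) - (D' - F x) := by abel
  rw [e, add_mul]
  exact (abs_sub _ _).trans (add_le_add (hC x hx φ hφ l hl hl1) (hC' x hx φ hφ l hl hl1))

end RegStruct

theorem mainTheorem5 (S : RegStruct.RegularityStructure.{u}) (d : ℕ) (hd : 1 ≤ d)
    (r : ℝ) (hr : |sInf S.A| < r) (M : RegStruct.Model S d r) (γ : ℝ) (hγ : 0 < γ) :
    ∃! R : RegStruct.Dgamma M γ →ₗ[ℝ] RegStruct.Distr d,
      ∀ f : RegStruct.Dgamma M γ, ∀ K : Set (RegStruct.Space d), IsCompact K →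
        ∃ C : ℝ, ∀ x ∈ K, ∀ φ ∈ RegStruct.testBall d r, ∀ l : ℝ, ∀ hl : 0 < l, l ≤ 1 →
          |(R f - M.Pi x ((f : RegStruct.Space d → S.ModelSpace) x))
            (RegStruct.rescale φ x l hl)| ≤ C * l ^ γ := by
  have hr0 : 0 ≤ r := (abs_nonneg _).trans hr.le
  choose R hR using RegStruct.exists_reconstruction hr0 M hγ
  -- The pointwise choice is automatically linear: `R f + R g` and `c • R f` satisfy the bounds that
  -- characterise `R (f + g)` and `R (c • f)`.
  refine ⟨{ toFun := R, map_add' := fun f g ↦ ?_, map_smul' := fun c f ↦ ?_ }, hR,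
    fun R' hR' ↦ LinearMap.ext fun f ↦ RegStruct.reconstruction_unique hr0 hγ (hR' f) (hR f)⟩
  · refine RegStruct.reconstruction_unique hr0 hγ (hR (f + g)) fun K hK ↦ ?_
    obtain ⟨C, hC⟩ := hR f K hK
    obtain ⟨C', hC'⟩ := hR g K hK
    refine ⟨C + C', fun x hx φ hφ l hl hl1 ↦ ?_⟩
    rw [Submodule.coe_add, Pi.add_apply, map_add, add_sub_add_comm, add_mul]
    exact (abs_add_le _ _).trans (add_le_add (hC x hx φ hφ l hl hl1) (hC' x hx φ hφ l hl hl1))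
  · refine RegStruct.reconstruction_unique hr0 hγ (hR (c • f)) fun K hK ↦ ?_
    obtain ⟨C, hC⟩ := hR f K hK
    refine ⟨|c| * C, fun x hx φ hφ l hl hl1 ↦ ?_⟩
    rw [Submodule.coe_smul, Pi.smul_apply, map_smul, RingHom.id_apply, ← smul_sub, mul_assoc]
    change |c * _| ≤ _
    rw [abs_mul]
    exact mul_le_mul_of_nonneg_left (hC x hx φ hφ l hl hl1) (abs_nonneg c)
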